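/- **Setting.** Let $\Omega_0,\Omega_1$ be Polish spaces with their Borel $\sigma$-algebras, let $\mathcal E\subseteq\Omega_0\times\Omega_1$ be closed and such that every vertex of either side has at least one neighbour, and let $\nu_0,\nu_1$ be finite Borel measures on $\Omega_0,\Omega_1$ with positive total mass. Fix $\iota\in\{0,1\}$ and put $\bar\iota=1-\iota$. For $j\in\{0,1\}$ let $\Pi_j$ be the set of finite measures $\pi$ on $\Omega_0\times\Omega_1$ with $\pi(\mathcal E^c)=0$ and $(\mathrm{pr}_j)_\#\pi=\nu_j$. For $y\in\Omega_{\bar\jmath}$ ($\bar\jmath=1-j$) let $N_j(y)\subseteq\Omega_j$ be its set of neighbours. For a measure $\eta$ on $\Omega_{\bar\jmath}$ and a kernel $K$ from $\Omega_{\bar\jmath}$ to $\Omega_j$ let $\eta\bowtie K$ be the measure on $\Omega_0\times\Omega_1$ that gives mass $\int_B K(y,A)\,\eta(dy)$ to the set of points with $j$-coordinate in $A$ and $\bar\jmath$-coordinate in $B$. * *Level-optimal maximin.* $\pi\in\Pi_j$ with opposite marginal $P=(\mathrm{pr}_{\bar\jmath})_\#\pi=r\,\nu_{\bar\jmath}+P^\perp$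 (Lebesgue decomposition) is level-optimal maximin from side $j$ to side $\bar\jmath$ if for every $t>0$, $\int (r\wedge t)\,d\nu_{\bar\jmath}$ equals the supremum of the total masses of the finite measures $\sigma$ on $\Omega_0\times\Omega_1$ with $\sigma(\mathcal E^c)=0$, $(\mathrm{pr}_j)_\#\sigma\le\nu_j$ and $(\mathrm{pr}_{\bar\jmath})_\#\sigma\le t\,\nu_{\bar\jmath}$. * *Proportional response.* Let $\pi\in\Pi_j$, $P=(\mathrm{pr}_{\bar\jmath})_\#\pi$, and let $\nu_{\bar\jmath}=\nu_{\mathrm{ac}}+\nu_\perp$ be the Lebesgue decomposition of $\nu_{\bar\jmath}$ with respect to $P$. A measure $\pi'$ is a proportional response to $\pi$ if $\pi'=\nu_{\mathrm{ac}}\bowtie K+\nu_\perp\bowtie K^{\mathrm{fb}}$ for a disintegration $\pi=P\bowtie K$ and a probability kernel $K^{\mathrm{fb}}$ from $\Omega_{\bar\jmath}$ to $\Omega_j$ with $K^{\mathrm{fb}}(y,\cdot)$ carried by $N_j(y)$ for $\nu_\perp$-a.e. $y$. * *Divergences.* For proper convex $\vartheta:[0,\infty)\to\mathbb R\cup\{+\infty\}$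 put $\vartheta'_\infty=\lim_{t\to\infty}\vartheta(t)/t$ and, for finite measures with Lebesgue decomposition $P=rQ+P^\perp$, $\mathsf D_\vartheta(P\|Q)=\int\vartheta(r)\,dQ+\vartheta'_\infty P^\perp(\Omega)$ (with $\infty\cdot0=0$). The adjoint integrand is $\widehat\vartheta(t)=t\,\vartheta(1/t)$ for $t>0$ and $\widehat\vartheta(0)=\vartheta'_\infty$. A pair $(\pi_\iota,\pi_{\bar\iota})\in\Pi_\iota\times\Pi_{\bar\iota}$ is $\mathsf D$-closest if $\mathsf D(\pi_\iota\|\pi_{\bar\iota})=\inf\{\mathsf D(\rho_\iota\|\rho_{\bar\iota}):\rho_\iota\in\Pi_\iota,\rho_{\bar\iota}\in\Pi_{\bar\iota}\}$. It is a universal closest pair if it is $\mathsf D$-closest for every extended-real-valued divergence $\mathsf D$ of finite measures that satisfies the data-processing inequality $\mathsf D(K_\#P\|K_\#Q)\le\mathsf D(P\|Q)$ for all Markov kernels $K$. **Theorem.** Let $\vartheta:[0,\infty)\to\mathbb R\cup\{+\infty\}$ be proper, lower semicontinuous and strictly convex on $\mathrm{dom}\,\vartheta$, and let $(\pi_\iota,\pi_{\bar\iota})\in\Pi_\iota\times\Pi_{\bar\iota}$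 satisfy $$\mathsf D_\vartheta(\pi_\iota\|\pi_{\bar\iota})=\inf_{(\rho_\iota,\rho_{\bar\iota})\in\Pi_\iota\times\Pi_{\bar\iota}}\mathsf D_\vartheta(\rho_\iota\|\rho_{\bar\iota})<+\infty .$$ Then: 1. $\pi_\iota$ is level-optimal maximin from side $\iota$ to side $\bar\iota$; 2. $\pi_{\bar\iota}$ is a proportional response to $\pi_\iota$; 3. the hypothesis is symmetric: $\widehat\vartheta$ is proper, lower semicontinuous and strictly convex on $\mathrm{dom}\,\widehat\vartheta$, $\mathsf D_\vartheta(\rho_\iota\|\rho_{\bar\iota})=\mathsf D_{\widehat\vartheta}(\rho_{\bar\iota}\|\rho_\iota)$ for all $(\rho_\iota,\rho_{\bar\iota})\in\Pi_\iota\times\Pi_{\bar\iota}$, and $(\pi_{\bar\iota},\pi_\iota)$ is a $\mathsf D_{\widehat\vartheta}$-closest pair with the sides exchanged, of value $<+\infty$; 4. consequently $\pi_{\bar\iota}$ is level-optimal maximin from side $\bar\iota$ to side $\iota$, and $\pi_\iota$ is a proportional response to $\pi_{\bar\iota}$. In particular, if $(\pi_\iota,\pi_{\bar\iota})$ is a universal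 closest pair, then both of its components are level-optimal maximin (from side $\iota$ to $\bar\iota$ and from $\bar\iota$ to $\iota$ respectively), and each is a proportional response to the other. -/

import Mathlib

open MeasureTheory ProbabilityTheory Filter
open scoped NNReal ENNReal

universe u

noncomputable section

namespace Refinement

/-! ### Bipartite relations

The two sides are indexed by `Bool` (`false` is side `0`, `true` is side `1`), and `!i` is the
side opposite to `i`.  Relations and plans always live on `Ω false × Ω true`. -/

section Sides

variable {Ω : Bool → Type u}

/-- The projection of `Ω false × Ω true` onto side `i`. -/
def proj : (i : Bool) → Ω false × Ω true → Ω i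
  | false, p => p.1
  | true, p => p.2

/-- The point of `Ω false × Ω true` whose `!i`-coordinate is `p.1` and `i`-coordinate is `p.2`. -/
def join : (i : Bool) → Ω (!i) × Ω i → Ω false × Ω true
  | false, p => (p.2, p.1)
  | true, p => (p.1, p.2)

/-- The neighbourhood `N_i(y) ⊆ Ω i` of a vertex `y` on the side opposite to `i`. -/
def nbhd (E : Set (Ω false × Ω true)) (i : Bool) (y : Ω (!i)) : Set (Ω i) :=
  {x | join i (y, x) ∈ E}

variable [∀ i, MeasurableSpace (Ω i)]

/-- The allocation refinements of `ν i`: finite measures carried by the relation `E` whose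
`i`-marginal is `ν i`. -/
def plans (E : Set (Ω false × Ω true)) (ν : ∀ i, Measure (Ω i)) (i : Bool) :
    Set (Measure (Ω false × Ω true)) :=
  {π | IsFiniteMeasure π ∧ π Eᶜ = 0 ∧ π.map (proj i) = ν i}

/-- The payload that a plan from side `i` induces on the opposite side: its other marginal. -/
def payload (i : Bool) (π : Measure (Ω false × Ω true)) : Measure (Ω (!i)) :=
  π.map (proj (!i))

/-! ### Level-optimal maximin -/

/-- The truncated absolutely continuous payload `(r ∧ t) ν`, where `r` is the density of the
absolutely continuous part of the payload of `π` with respect to the opposite side measure `ν`. -/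
def truncatedPayload (ν : ∀ i, Measure (Ω i)) (i : Bool) (π : Measure (Ω false × Ω true))
    (t : ℝ≥0) : Measure (Ω (!i)) :=
  (ν (!i)).withDensity fun y => min ((payload i π).rnDeriv (ν (!i)) y) (t : ℝ≥0∞)

/-- Subplans from side `i` that respect the density cap `t` on the opposite side. -/
def feas (E : Set (Ω false × Ω true)) (ν : ∀ i, Measure (Ω i)) (i : Bool) (t : ℝ≥0) :
    Set (Measure (Ω false × Ω true)) :=
  {σ | IsFiniteMeasure σ ∧ σ Eᶜ = 0 ∧ σ.map (proj i) ≤ ν i ∧ σ.map (proj (!i)) ≤ t • ν (!i)}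

/-- The largest mass of a subplan from side `i` below the density cap `t` on the opposite side. -/
def fit (E : Set (Ω false × Ω true)) (ν : ∀ i, Measure (Ω i)) (i : Bool) (t : ℝ≥0) : ℝ≥0∞ :=
  ⨆ σ ∈ feas E ν i t, σ Set.univ

/-- `π` is level-optimal maximin from side `i` to the opposite side. -/
def IsLevelOptimalMaximin (E : Set (Ω false × Ω true)) (ν : ∀ i, Measure (Ω i)) (i : Bool)
    (π : Measure (Ω false × Ω true)) : Prop :=
  π ∈ plans E ν i ∧ ∀ t : ℝ≥0, 0 < t → truncatedPayload ν i π t Set.univ = fit E ν i t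

/-! ### Proportional response -/

/-- The measure on `Ω false × Ω true` obtained from a measure on side `!i` and a kernel from side
`!i` to side `i`. -/
def kernelProduct (i : Bool) (η : Measure (Ω (!i))) (K : Kernel (Ω (!i)) (Ω i)) :
    Measure (Ω false × Ω true) :=
  (η ⊗ₘ K).map (join i)

/-- `K` is a disintegration of `π` with respect to the measure `μ` on side `!i`.  The values of `K`
are finite measures, so `K` is an s-finite kernel and the kernel product is the usual one. -/
def IsDisintegration (i : Bool) (π : Measure (Ω false × Ω true)) (μ : Measure (Ω (!i)))
    (K : Kernel (Ω (!i)) (Ω i)) : Prop :=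
  (∀ y, IsFiniteMeasure (K y)) ∧ π = kernelProduct i μ K

/-- `π'` is a proportional response to the plan `π` from side `i`.  With `P` the payload of `π`,
the absolutely continuous part of `ν (!i)` with respect to `P` is distributed by a reverse
disintegration of `π`, the singular part by a probability kernel carried by the neighbourhoods. -/
def IsProportionalResponse (E : Set (Ω false × Ω true)) (ν : ∀ i, Measure (Ω i)) (i : Bool)
    (π π' : Measure (Ω false × Ω true)) : Prop :=
  π ∈ plans E ν i ∧
  ∃ K Kfb : Kernel (Ω (!i)) (Ω i),
    IsDisintegration i π (payload i π) K ∧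
    IsMarkovKernel Kfb ∧
    (∀ᵐ y ∂((ν (!i)).singularPart (payload i π)), Kfb y (nbhd E i y)ᶜ = 0) ∧
    π' = kernelProduct i ((payload i π).withDensity ((ν (!i)).rnDeriv (payload i π))) K
      + kernelProduct i ((ν (!i)).singularPart (payload i π)) Kfb

end Sides

/-! ### Divergences -/

/-- A family of maps from pairs of measures to the extended reals, one for each measurable space.
Only its values on finite measures are ever used. -/
abbrev Divergence : Type (u + 1) :=
  ∀ (X : Type u) [MeasurableSpace X], Measure X → Measure X → EReal

/-- The data-processing inequality under Markov kernels, for finite measures. -/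
def SatisfiesDPI (D : Divergence.{u}) : Prop :=
  ∀ (X Y : Type u) [MeasurableSpace X] [MeasurableSpace Y] (K : Kernel X Y) [IsMarkovKernel K]
    (P Q : Measure X) [IsFiniteMeasure P] [IsFiniteMeasure Q],
    D Y (P.bind K) (Q.bind K) ≤ D X P Q

/-- `(π, π')`, with `π` from side `i` and `π'` from the opposite side, attains the infimum of `D`
over all pairs of refinements. -/
def IsClosestPair {Ω : Bool → Type u} [∀ i, MeasurableSpace (Ω i)] (D : Divergence.{u})
    (E : Set (Ω false × Ω true)) (ν : ∀ i, Measure (Ω i)) (i : Bool)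
    (π π' : Measure (Ω false × Ω true)) : Prop :=
  π ∈ plans E ν i ∧ π' ∈ plans E ν (!i) ∧
  D (Ω false × Ω true) π π' =
    ⨅ ρ ∈ plans E ν i, ⨅ ρ' ∈ plans E ν (!i), D (Ω false × Ω true) ρ ρ'

/-- `(π, π')` is a closest pair simultaneously for all divergences with data processing. -/
def IsUniversalClosestPair {Ω : Bool → Type u} [∀ i, MeasurableSpace (Ω i)]
    (E : Set (Ω false × Ω true)) (ν : ∀ i, Measure (Ω i)) (i : Bool)
    (π π' : Measure (Ω false × Ω true)) : Prop :=
  ∀ D : Divergence.{u}, SatisfiesDPI D → IsClosestPair D E ν i π π'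

/-- A function `[0, ∞) → ℝ ∪ {+∞}` that is not identically `+∞`. -/
def IsProper (θ : ℝ≥0 → EReal) : Prop :=
  (∀ t, θ t ≠ ⊥) ∧ ∃ t, θ t ≠ ⊤

/-- Strict convexity on the effective domain `{θ < +∞}`, including convexity of that domain (the
right-hand side is then `< +∞`). -/
def IsStrictlyConvexOnDom (θ : ℝ≥0 → EReal) : Prop :=
  ∀ x y : ℝ≥0, θ x ≠ ⊤ → θ y ≠ ⊤ → x ≠ y → ∀ a b : ℝ≥0, 0 < a → 0 < b → a + b = 1 →
    θ (a * x + b * y) < ((a : ℝ) : EReal) * θ x + ((b : ℝ) : EReal) * θ y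

/-- The recession slope `lim θ(t) / t` as `t → ∞`; the limit exists for proper convex `θ`, so it is
the upper limit. -/
def recessionSlope (θ : ℝ≥0 → EReal) : EReal :=
  limsup (fun t : ℝ≥0 => θ t / ((t : ℝ) : EReal)) atTop

/-- The integral of an extended-real function, positive part minus negative part. -/
def extIntegral {X : Type u} [MeasurableSpace X] (f : X → EReal) (μ : Measure X) : EReal :=
  ((∫⁻ x, (f x).toENNReal ∂μ : ℝ≥0∞) : EReal) - ((∫⁻ x, (-f x).toENNReal ∂μ : ℝ≥0∞) : EReal)

/-- The `θ`-divergence `∫ θ(r) dQ + θ'_∞ P⊥(X)`, where `P = r Q + P⊥` is the Lebesgue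
decomposition. In `EReal`, `⊤ * 0 = 0` and `⊤ * m = ⊤` for `m > 0`. -/
def thetaDiv (θ : ℝ≥0 → EReal) : Divergence.{u} := fun _ _ P Q =>
  extIntegral (fun x => θ (P.rnDeriv Q x).toNNReal) Q
    + recessionSlope θ * ((P.singularPart Q Set.univ : ℝ≥0∞) : EReal)

/-- The adjoint integrand: `t θ(1/t)` for `t > 0`, and the recession slope of `θ` at `t = 0`. -/
def adjoint (θ : ℝ≥0 → EReal) (t : ℝ≥0) : EReal :=
  if t = 0 then recessionSlope θ else ((t : ℝ) : EReal) * θ t⁻¹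

end Refinement

end

/-!
The divergence of two measures `p m` and `q m` is, up to an affine function of the total masses,
the integral `∫ Φ(p, q) dm` of the perspective `Φ(p, q) = q ψ(p / q)`, `Φ(p, 0) = p ψ'_∞`, whatever
the dominating measure `m` (`divg_withDensity`, `IsNormalization.thetaDiv_eq`); here
`ψ(t) = θ(t) - (A t + B) ≥ 0` for some affine minorant of `θ`. The masses of plans are prescribed,
so closest pairs do not depend on the choice of the minorant. The perspective of the adjoint
integrand is `Φ` with its arguments exchanged, which gives the symmetry of the hypotheses
(`thetaDiv_adjoint`); the second half of the structure of the pair is the first half for the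
adjoint integrand.

Let `P` be the payload of `π`, on the side opposite to `i`, and `ν` the measure on that side.
Projecting a pair of plans to this side does not increase the divergence, and every plan `ρ` of
side `i` has a response `ρ'` for which the divergence of the pair is that of the projections
(`exists_response`). Hence `D(π‖π') = D(P‖ν)`, and `P` minimizes `D(·‖ν)` among the payloads of all
plans of side `i`.

* Equality in the projection inequality is equality in Jensen's inequality for the conditional
  laws. By strict convexity the densities of `π` and `π'` with respect to `π + π'` depend on the
  projected coordinate only, so that a single kernel `κ` disintegrates both plans
  (`IsNormalization.divg_fst`). This `κ` serves both as the reverse disintegration and as the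
  fallback kernel of a proportional response; no measurable selection of neighbours is needed.

* Let `σ` be a subplan whose payload has density at most `t`, and let `r < t`. If some vertices were
  matched by `π` to points of payload density at least `t`, and by `σ` to points of payload density
  below `r`, one could move a little of their mass from the former points to the latter. The bound
  on the payload of `σ` keeps the densities on their side of the midpoint `c` of `r` and `t`, and
  with `ψ` normalized by the supporting line at `c`, so that `ψ` decreases before `c` and increases
  after it, `Φ` decreases pointwise: this contradicts the minimality of `P`. So the vertices that
  `σ` sends below `r` are sent by `π` below `t` (`exchange`), and `r ↑ t` bounds the mass of `σ` by
  that of the truncated payload (`mass_le_truncated`).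

For universal closest pairs, one strictly convex integrand with data processing and finite
divergence suffices. For `t ↦ 1 / (1 + t)` the divergence of `P` and `Q` is `∫ q ² d(P + Q)`, `q`
being the density of `Q` with respect to `P + Q`, and data processing follows from
`2 a b ≤ a ² + b ²` (`satisfiesDPI_invIntegrand`).
-/

namespace Refinement

/-! ### Strictly convex integrands -/

section Convex

variable {θ : ℝ≥0 → EReal}

theorem IsProper.coe_toReal (hp : IsProper θ) {x : ℝ≥0} (hx : θ x ≠ ⊤) :
    (((θ x).toReal : ℝ) : EReal) = θ x :=
  EReal.coe_toReal hx (hp.1 x)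

/-- The three-chord inequality, free of divisions; the intermediate point is in the domain. -/
theorem IsStrictlyConvexOnDom.three_point (hc : IsStrictlyConvexOnDom θ) (hp : IsProper θ)
    {x c y : ℝ≥0} (hxc : x < c) (hcy : c < y) (hx : θ x ≠ ⊤) (hy : θ y ≠ ⊤) :
    θ c ≠ ⊤ ∧ ((y : ℝ) - x) * (θ c).toReal <
      ((y : ℝ) - c) * (θ x).toReal + ((c : ℝ) - x) * (θ y).toReal := by
  have hxc' : (x : ℝ) < c := hxc
  have hcy' : (c : ℝ) < y := hcy
  have hd : (0 : ℝ) < y - x := by linarith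
  obtain ⟨a, ha⟩ : ∃ a : ℝ≥0, (a : ℝ) = (y - c) / (y - x) :=
    CanLift.prf (_ : ℝ) (div_nonneg (by linarith) (by linarith))
  obtain ⟨b, hb⟩ : ∃ b : ℝ≥0, (b : ℝ) = (c - x) / (y - x) :=
    CanLift.prf (_ : ℝ) (div_nonneg (by linarith) (by linarith))
  have h := hc x y hx hy (hxc.trans hcy).ne a b
    (by rw [← NNReal.coe_pos, ha]; exact div_pos (by linarith) hd)
    (by rw [← NNReal.coe_pos, hb]; exact div_pos (by linarith) hd)
    (by rw [← NNReal.coe_inj]; push_cast; rw [ha, hb]; field_simp; ring)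
  have hcomb : a * x + b * y = c := by
    rw [← NNReal.coe_inj]; push_cast; rw [ha, hb]; field_simp; ring
  rw [hcomb, ← hp.coe_toReal hx, ← hp.coe_toReal hy, ← EReal.coe_mul, ← EReal.coe_mul,
    ← EReal.coe_add] at h
  have hct : θ c ≠ ⊤ := (h.trans (EReal.coe_lt_top _)).ne
  refine ⟨hct, ?_⟩
  rw [← hp.coe_toReal hct, EReal.coe_lt_coe_iff] at h
  rw [ha, hb, div_mul_eq_mul_div, div_mul_eq_mul_div, ← add_div, lt_div_iff₀ hd] at h
  linarith

/-- A strictly convex integrand has a supporting line at every point strictly between two points of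
its domain, and the line touches the graph only there. -/
theorem IsStrictlyConvexOnDom.exists_support (hc : IsStrictlyConvexOnDom θ) (hp : IsProper θ)
    {x₁ c x₂ : ℝ≥0} (h₁ : x₁ < c) (h₂ : c < x₂) (hx₁ : θ x₁ ≠ ⊤) (hx₂ : θ x₂ ≠ ⊤) :
    ∃ A B : ℝ, θ c = ((A * c + B : ℝ) : EReal) ∧
      ∀ x, x ≠ c → ((A * x + B : ℝ) : EReal) < θ x := by
  have hct : θ c ≠ ⊤ := (hc.three_point hp h₁ h₂ hx₁ hx₂).1
  set S : Set ℝ := {a | ∃ x : ℝ≥0, x < c ∧ θ x ≠ ⊤ ∧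
    a = ((θ c).toReal - (θ x).toReal) / ((c : ℝ) - x)} with hS
  have hub : ∀ y : ℝ≥0, c < y → θ y ≠ ⊤ → ∀ a ∈ S,
      a ≤ ((θ y).toReal - (θ c).toReal) / ((y : ℝ) - c) := by
    rintro y hcy hy a ⟨x, hxc, hx, rfl⟩
    have h := (hc.three_point hp hxc hcy hx hy).2
    have hxc' : (x : ℝ) < c := hxc
    have hcy' : (c : ℝ) < y := hcy
    rw [div_le_div_iff₀ (by linarith) (by linarith)]
    nlinarith
  have hbdd : BddAbove S := ⟨_, hub x₂ h₂ hx₂⟩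
  have hne : S.Nonempty := ⟨_, x₁, h₁, hx₁, rfl⟩
  -- The left derivative at `c`.
  set A := sSup S
  have hweak : ∀ x, θ x ≠ ⊤ → A * x + ((θ c).toReal - A * c) ≤ (θ x).toReal := by
    intro x hx
    rcases lt_trichotomy x c with hxc | rfl | hxc
    · have hxc' : (x : ℝ) < c := hxc
      have := le_csSup hbdd (show _ ∈ S from ⟨x, hxc, hx, rfl⟩)
      rw [div_le_iff₀ (by linarith)] at this
      linarith
    · linarith
    · have hxc' : (c : ℝ) < x := hxc
      have := csSup_le hne (hub x hxc hx)
      rw [le_div_iff₀ (by linarith)] at this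
      linarith
  refine ⟨A, (θ c).toReal - A * c, by rw [← hp.coe_toReal hct]; norm_num, fun x hxc => ?_⟩
  by_cases hx : θ x = ⊤
  · rw [hx]; exact EReal.coe_lt_top _
  rw [← hp.coe_toReal hx, EReal.coe_lt_coe_iff]
  -- Equality at `x` would push the graph below the line at the midpoint of `x` and `c`.
  rcases lt_or_gt_of_ne hxc with hlt | hlt
  · have hlt' : (x : ℝ) < c := hlt
    obtain ⟨hz, h⟩ := hc.three_point hp (c := (x + c) / 2)
      (left_lt_add_div_two.2 hlt) (add_div_two_lt_right.2 hlt) hx hct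
    have hw := hweak _ hz
    push_cast at hw h
    nlinarith
  · have hlt' : (c : ℝ) < x := hlt
    obtain ⟨hz, h⟩ := hc.three_point hp (c := (c + x) / 2)
      (left_lt_add_div_two.2 hlt) (add_div_two_lt_right.2 hlt) hct hx
    have hw := hweak _ hz
    push_cast at hw h
    nlinarith

/-- A chord of slope at least `K` forces growth of slope at least `K` to its right. -/
theorem IsStrictlyConvexOnDom.growth (hc : IsStrictlyConvexOnDom θ) (hp : IsProper θ)
    {z w : ℝ≥0} {K : ℝ} (hzw : z < w) (hz : θ z ≠ ⊤)
    (hw : (((θ z).toReal + K * (w - z) : ℝ) : EReal) ≤ θ w) {v : ℝ≥0} (hv : w ≤ v) :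
    (((θ z).toReal + K * (v - z) : ℝ) : EReal) ≤ θ v := by
  rcases hv.eq_or_lt with rfl | hwv
  · exact hw
  by_cases hvt : θ v = ⊤
  · rw [hvt]; exact le_top
  obtain ⟨hwt, h⟩ := hc.three_point hp hzw hwv hz hvt
  rw [← hp.coe_toReal hvt, EReal.coe_le_coe_iff]
  rw [← hp.coe_toReal hwt, EReal.coe_le_coe_iff] at hw
  have h1 : (z : ℝ) < w := hzw
  have h2 : (w : ℝ) < v := hwv
  have h3 : ((v : ℝ) - z) * ((θ z).toReal + K * (w - z)) ≤ (v - z) * (θ w).toReal :=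
    mul_le_mul_of_nonneg_left hw (by linarith)
  have h4 : ((w : ℝ) - z) * ((θ z).toReal + K * (v - z)) ≤ (w - z) * (θ v).toReal := by nlinarith
  exact le_of_mul_le_mul_left h4 (by linarith)

/-- An affine minorant of slope `K` near infinity keeps `θ(v) / v` eventually above every
`y < K`. -/
theorem eventually_lt_div {K C : ℝ} {w : ℝ≥0} {y : EReal} (hy : y < K)
    (h : ∀ v, w ≤ v → ((K * v + C : ℝ) : EReal) ≤ θ v) :
    ∀ᶠ v : ℝ≥0 in atTop, y < θ v / ((v : ℝ) : EReal) := by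
  have hlim : Tendsto (fun v : ℝ≥0 => ((K + C / v : ℝ) : EReal)) atTop (nhds (K : EReal)) := by
    refine (continuous_coe_real_ereal.tendsto K).comp ?_
    have : Tendsto (fun v : ℝ≥0 => C / (v : ℝ)) atTop (nhds 0) :=
      tendsto_const_nhds.div_atTop (NNReal.tendsto_coe_atTop.2 tendsto_id)
    simpa using tendsto_const_nhds.add this
  filter_upwards [hlim.eventually (lt_mem_nhds hy), eventually_ge_atTop w, eventually_gt_atTop 0]
    with v h1 h2 h3
  refine h1.trans_le ?_
  have h3' : (0 : ℝ) < v := h3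
  calc ((K + C / v : ℝ) : EReal) = ((K * v + C : ℝ) : EReal) / ((v : ℝ) : EReal) := by
        rw [← EReal.coe_div]; congr 1; field_simp
    _ ≤ _ := EReal.div_le_div_right_of_nonneg (by exact_mod_cast h3'.le) (h v h2)

theorem le_recessionSlope {K C : ℝ} {w : ℝ≥0}
    (h : ∀ v, w ≤ v → ((K * v + C : ℝ) : EReal) ≤ θ v) : (K : EReal) ≤ recessionSlope θ := by
  refine le_of_forall_lt fun y hy => ?_
  obtain ⟨y', h1, h2⟩ := exists_between hy
  exact h1.trans_le (le_limsup_of_frequently_le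
    ((eventually_lt_div h2 h).mono fun _ h => h.le).frequently)

theorem IsStrictlyConvexOnDom.slope_le_recessionSlope (hc : IsStrictlyConvexOnDom θ)
    (hp : IsProper θ) {z w : ℝ≥0} {K : ℝ} (hzw : z < w) (hz : θ z ≠ ⊤)
    (hw : (((θ z).toReal + K * (w - z) : ℝ) : EReal) ≤ θ w) : (K : EReal) ≤ recessionSlope θ :=
  le_recessionSlope (w := w) (C := (θ z).toReal - K * z) fun v hv => by
    convert hc.growth hp hzw hz hw hv using 2; ring

/-- Finite recession slope: the domain is unbounded to the right. -/
theorem IsStrictlyConvexOnDom.ne_top_of_recessionSlope (hc : IsStrictlyConvexOnDom θ)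
    (hp : IsProper θ) (hr : recessionSlope θ ≠ ⊤) {z w : ℝ≥0} (hzw : z ≤ w) (hz : θ z ≠ ⊤) :
    θ w ≠ ⊤ := by
  rcases hzw.eq_or_lt with rfl | hzw
  · exact hz
  intro hw
  refine hr (EReal.eq_top_iff_forall_lt _ |>.2 fun K => ?_)
  exact lt_of_lt_of_le (EReal.coe_lt_coe_iff.2 (lt_add_one K))
    (hc.slope_le_recessionSlope hp (K := K + 1) hzw hz (by rw [hw]; exact le_top))

/-- Chords of a strictly convex integrand have slope strictly below a finite recession slope. -/
theorem IsStrictlyConvexOnDom.lt_recession (hc : IsStrictlyConvexOnDom θ) (hp : IsProper θ)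
    {R : ℝ} (hr : recessionSlope θ = R) {z w : ℝ≥0} (hzw : z < w) (hz : θ z ≠ ⊤) :
    (θ w).toReal < (θ z).toReal + R * (w - z) := by
  have hrt : recessionSlope θ ≠ ⊤ := by rw [hr]; exact EReal.coe_ne_top _
  have hle : ∀ v : ℝ≥0, z < v → (θ v).toReal ≤ (θ z).toReal + R * (v - z) := by
    intro v hv
    have hvt := hc.ne_top_of_recessionSlope hp hrt hv.le hz
    have hv' : (z : ℝ) < v := hv
    have h := hc.slope_le_recessionSlope hp (K := ((θ v).toReal - (θ z).toReal) / (v - z)) hv hz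
      (by
        rw [← hp.coe_toReal hvt, EReal.coe_le_coe_iff, div_mul_cancel₀ _ (by linarith)]
        simp)
    rw [hr, EReal.coe_le_coe_iff, div_le_iff₀ (by linarith)] at h
    linarith
  have hw1 : w < w + 1 := lt_add_one w
  have h1 := hle (w + 1) (hzw.trans hw1)
  have h2 := (hc.three_point hp hzw hw1 hz
    (hc.ne_top_of_recessionSlope hp hrt (hzw.trans hw1).le hz)).2
  have hzw' : (z : ℝ) < w := hzw
  push_cast at h1 h2
  have h3 := mul_le_mul_of_nonneg_left h1 (show (0 : ℝ) ≤ w - z by linarith)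
  nlinarith

/-- The slope of the supporting line at a point is below the recession slope. -/
theorem IsStrictlyConvexOnDom.support_lt_recessionSlope (hc : IsStrictlyConvexOnDom θ)
    (hp : IsProper θ) {A B : ℝ} {c : ℝ≥0} (hcc : θ c = ((A * c + B : ℝ) : EReal))
    (h : ∀ x, x ≠ c → ((A * x + B : ℝ) : EReal) < θ x) : (A : EReal) < recessionSlope θ := by
  have hct : θ c ≠ ⊤ := by rw [hcc]; exact EReal.coe_ne_top _
  have hlt := h (c + 1) (lt_add_one c).ne'
  obtain ⟨K, hK1, hK2⟩ := EReal.lt_iff_exists_real_btwn.1 hlt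
  have hK1' := EReal.coe_lt_coe_iff.1 hK1
  push_cast at hK1'
  have h1 := hc.slope_le_recessionSlope hp (K := K - (A * c + B)) (lt_add_one c) hct (by
    rw [hcc, EReal.toReal_coe]
    convert hK2.le using 2
    push_cast; ring)
  exact lt_of_lt_of_le (EReal.coe_lt_coe_iff.2 (by linarith)) h1

/-- A supporting line is an affine minorant; if the domain is a single point, a constant is one. -/
theorem IsStrictlyConvexOnDom.exists_minorant (hc : IsStrictlyConvexOnDom θ) (hp : IsProper θ) :
    ∃ A B : ℝ, ∀ x : ℝ≥0, ((A * x + B : ℝ) : EReal) ≤ θ x := by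
  obtain ⟨x₀, hx₀⟩ := hp.2
  by_cases h : ∃ y, y ≠ x₀ ∧ θ y ≠ ⊤
  · obtain ⟨y, hne, hy⟩ := h
    obtain ⟨a, b, hab, ha, hb⟩ : ∃ a b : ℝ≥0, a < b ∧ θ a ≠ ⊤ ∧ θ b ≠ ⊤ := by
      rcases lt_or_gt_of_ne hne with h | h
      exacts [⟨_, _, h, hy, hx₀⟩, ⟨_, _, h, hx₀, hy⟩]
    obtain ⟨A, B, h1, h2⟩ := hc.exists_support hp (left_lt_add_div_two.2 hab)
      (add_div_two_lt_right.2 hab) ha hb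
    refine ⟨A, B, fun x => ?_⟩
    by_cases hx : x = (a + b) / 2
    · rw [hx, h1]
    · exact (h2 x hx).le
  · push Not at h
    refine ⟨0, (θ x₀).toReal, fun x => ?_⟩
    by_cases hx : x = x₀
    · rw [hx]; simp [hp.coe_toReal hx₀]
    · rw [h x hx]; exact le_top

end Convex

/-! ### Divergences as integrals of perspectives -/

/-- The perspective `q ψ(p / q)` of `ψ`, extended by `p s` at `q = 0`, where `s` stands for the
recession slope of `ψ`. -/
noncomputable def persp (ψ : ℝ≥0 → ℝ≥0∞) (s : ℝ≥0∞) (p q : ℝ≥0) : ℝ≥0∞ :=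
  if q = 0 then p * s else q * ψ (p / q)

/-- The decomposition `θ t = ψ t + (A t + B)` of an integrand into a nonnegative part and an affine
part, together with the corresponding decomposition `θ'_∞ = s + A` of the recession slope. -/
structure IsNormalization (θ : ℝ≥0 → EReal) (A B : ℝ) (ψ : ℝ≥0 → ℝ≥0∞) (s : ℝ≥0∞) : Prop where
  measurable : Measurable ψ
  eq : ∀ t : ℝ≥0, θ t = (ψ t : EReal) + ((A * t + B : ℝ) : EReal)
  slope : recessionSlope θ = (s : EReal) + (A : EReal)

theorem le_recessionSlope_of_minorant {θ : ℝ≥0 → EReal} {A B : ℝ}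
    (h : ∀ x : ℝ≥0, ((A * x + B : ℝ) : EReal) ≤ θ x) : (A : EReal) ≤ recessionSlope θ :=
  le_recessionSlope (w := 0) fun v _ => h v

theorem exists_isNormalization {θ : ℝ≥0 → EReal} (hθ : Measurable θ) {A B : ℝ}
    (h : ∀ x : ℝ≥0, ((A * x + B : ℝ) : EReal) ≤ θ x) : ∃ ψ s, IsNormalization θ A B ψ s := by
  refine ⟨fun x => (θ x - ((A * x + B : ℝ) : EReal)).toENNReal, (recessionSlope θ - A).toENNReal,
    ?_, fun t => ?_, ?_⟩
  · simp only [sub_eq_add_neg, ← EReal.coe_neg]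
    exact (hθ.add (by fun_prop)).ereal_toENNReal
  · rw [EReal.coe_toENNReal, EReal.sub_add_cancel]
    exact EReal.sub_nonneg (.inr (EReal.coe_ne_top _)) (.inr (EReal.coe_ne_bot _)) |>.2 (h t)
  · rw [EReal.coe_toENNReal, EReal.sub_add_cancel]
    exact EReal.sub_nonneg (.inr (EReal.coe_ne_top _)) (.inr (EReal.coe_ne_bot _)) |>.2
      (le_recessionSlope_of_minorant h)

section Normalization

variable {θ : ℝ≥0 → EReal} {A B : ℝ} {ψ : ℝ≥0 → ℝ≥0∞} {s : ℝ≥0∞}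

theorem IsNormalization.ne_top_iff (hn : IsNormalization θ A B ψ s) {x : ℝ≥0} :
    ψ x ≠ ⊤ ↔ θ x ≠ ⊤ := by
  rw [hn.eq, not_iff_not]
  refine ⟨fun h => by rw [h]; rfl, fun h => ?_⟩
  by_contra hx
  lift ψ x to ℝ≥0 using hx with r
  exact EReal.coe_ne_top ((r : ℝ) + (A * x + B)) h

theorem IsNormalization.slope_ne_top_iff (hn : IsNormalization θ A B ψ s) :
    s ≠ ⊤ ↔ recessionSlope θ ≠ ⊤ := by
  rw [hn.slope, not_iff_not]
  refine ⟨fun h => by rw [h]; rfl, fun h => ?_⟩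
  by_contra hx
  lift s to ℝ≥0 using hx with r
  exact EReal.coe_ne_top ((r : ℝ) + A) h

theorem IsNormalization.toReal (hn : IsNormalization θ A B ψ s) {x : ℝ≥0} (hx : θ x ≠ ⊤) :
    (θ x).toReal = (ψ x).toReal + (A * x + B) := by
  have hψ := hn.ne_top_iff.2 hx
  rw [hn.eq]
  lift ψ x to ℝ≥0 using hψ with r
  exact EReal.toReal_coe ((r : ℝ) + (A * x + B))

theorem IsNormalization.slope_toReal (hn : IsNormalization θ A B ψ s) (hs : s ≠ ⊤) :
    recessionSlope θ = ((s.toReal + A : ℝ) : EReal) := by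
  rw [hn.slope]
  lift s to ℝ≥0 using hs with r
  rfl

end Normalization

/-- The integral splits although `f` may have infinite integral: the negative part is bounded by
that of `g`, so no `⊤ - ⊤` arises. -/
theorem extIntegral_coe_add {X : Type u} [MeasurableSpace X] {μ : Measure X} {f : X → ℝ≥0∞}
    (hf : Measurable f) {g : X → ℝ} (hg : Measurable g) (hgi : Integrable g μ) :
    extIntegral (fun x => (f x : EReal) + ((g x : ℝ) : EReal)) μ =
      ((∫⁻ x, f x ∂μ : ℝ≥0∞) : EReal) + ((∫ x, g x ∂μ : ℝ) : EReal) := by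
  set F : X → EReal := fun x => (f x : EReal) + ((g x : ℝ) : EReal) with hF
  have hFm : Measurable F := hf.coe_ereal_ennreal.add hg.coe_real_ereal
  have hpt : ∀ x, (F x).toENNReal + ENNReal.ofReal (-g x) =
      f x + ENNReal.ofReal (g x) + (-F x).toENNReal := by
    intro x
    simp only [hF]
    by_cases hx : f x = ⊤
    · simp [hx]
    lift f x to ℝ≥0 using hx with r
    have e1 : ((r : ℝ≥0∞) : EReal) + ((g x : ℝ) : EReal) = (((r : ℝ) + g x : ℝ) : EReal) := rfl
    rw [e1, ← EReal.coe_neg, EReal.real_coe_toENNReal, EReal.real_coe_toENNReal,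
      ← ENNReal.toReal_eq_toReal_iff' (by finiteness) (by finiteness), ENNReal.toReal_add
      (by finiteness) (by finiteness), ENNReal.toReal_add (by finiteness) (by finiteness),
      ENNReal.toReal_add (by finiteness) (by finiteness)]
    simp only [ENNReal.toReal_ofReal', ENNReal.coe_toReal]
    have h1 := max_zero_sub_max_neg_zero_eq_self (g x)
    have h2 := max_zero_sub_max_neg_zero_eq_self ((r : ℝ) + g x)
    linarith
  have hint : (∫⁻ x, (F x).toENNReal ∂μ) + ∫⁻ x, ENNReal.ofReal (-g x) ∂μ =
      (∫⁻ x, f x ∂μ) + (∫⁻ x, ENNReal.ofReal (g x) ∂μ) + ∫⁻ x, (-F x).toENNReal ∂μ := by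
    rw [← lintegral_add_left hFm.ereal_toENNReal, ← lintegral_add_left hf,
      ← lintegral_add_right (g := fun x => (-F x).toENNReal) _
        (continuous_neg.measurable.comp hFm).ereal_toENNReal]
    exact lintegral_congr hpt
  have h3 : ∫⁻ x, ENNReal.ofReal (g x) ∂μ ≠ ⊤ := hgi.lintegral_lt_top.ne
  have h4 : ∫⁻ x, ENNReal.ofReal (-g x) ∂μ ≠ ⊤ := hgi.neg.lintegral_lt_top.ne
  have h5 : ∫⁻ x, (-F x).toENNReal ∂μ ≠ ⊤ := by
    refine ne_top_of_le_ne_top h4 (lintegral_mono fun x => ?_)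
    have : -F x ≤ ((-g x : ℝ) : EReal) := by
      rw [EReal.coe_neg, EReal.neg_le_neg_iff]
      exact le_add_of_nonneg_left (EReal.coe_ennreal_nonneg _)
    exact EReal.toENNReal_le_toENNReal this
  rw [extIntegral, integral_eq_lintegral_pos_part_sub_lintegral_neg_part hgi]
  change ((∫⁻ x, (F x).toENNReal ∂μ : ℝ≥0∞) : EReal) - ((∫⁻ x, (-F x).toENNReal ∂μ : ℝ≥0∞) : EReal)
    = _
  generalize ∫⁻ x, (F x).toENNReal ∂μ = a at *
  generalize ∫⁻ x, (-F x).toENNReal ∂μ = b at *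
  generalize ∫⁻ x, ENNReal.ofReal (g x) ∂μ = c at *
  generalize ∫⁻ x, ENNReal.ofReal (-g x) ∂μ = d at *
  generalize ∫⁻ x, f x ∂μ = e at *
  lift b to ℝ≥0 using h5
  lift c to ℝ≥0 using h3
  lift d to ℝ≥0 using h4
  by_cases he : e = ⊤
  · have ha : a = ⊤ := by
      rw [he, top_add, top_add] at hint
      simpa using hint
    rw [he, ha]
    rfl
  lift e to ℝ≥0 using he
  have ha : a ≠ ⊤ := by
    intro ha
    rw [ha, top_add] at hint
    exact (by finiteness : ((e : ℝ≥0∞) + c + b) ≠ ⊤) hint.symm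
  lift a to ℝ≥0 using ha
  have hr : (a : ℝ) + d = e + c + b := by exact_mod_cast hint
  have : (a : ℝ) - b = e + (c - d) := by linarith
  exact congrArg Real.toEReal this

section Density

variable {X : Type u} [MeasurableSpace X]

theorem measurable_persp {ψ : ℝ≥0 → ℝ≥0∞} (hψ : Measurable ψ) (s : ℝ≥0∞) {p q : X → ℝ≥0}
    (hp : Measurable p) (hq : Measurable q) : Measurable fun x => persp ψ s (p x) (q x) := by
  unfold persp
  exact Measurable.ite (hq (measurableSet_singleton 0)) (by fun_prop) (by fun_prop)

/-- The `ψ`-divergence with recession slope `s` for a nonnegative integrand. -/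
noncomputable def divg (ψ : ℝ≥0 → ℝ≥0∞) (s : ℝ≥0∞) (P Q : Measure X) : ℝ≥0∞ :=
  ∫⁻ x, ψ (P.rnDeriv Q x).toNNReal ∂Q + s * P.singularPart Q Set.univ

/-- The Lebesgue decomposition of `p m` with respect to `q m`: the singular part lives on `q = 0`,
and the density of the rest is `p / q`. -/
theorem lebesgue_withDensity {m : Measure X} {p q : X → ℝ≥0} (hp : Measurable p)
    (hq : Measurable q) :
    (m.withDensity fun x => if q x = 0 then (p x : ℝ≥0∞) else 0) ⟂ₘ
        m.withDensity (fun x => (q x : ℝ≥0∞)) ∧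
      m.withDensity (fun x => (p x : ℝ≥0∞)) =
        (m.withDensity fun x => if q x = 0 then (p x : ℝ≥0∞) else 0) +
        (m.withDensity fun x => (q x : ℝ≥0∞)).withDensity
          fun x => ((p x / q x : ℝ≥0) : ℝ≥0∞) := by
  have hS : MeasurableSet {x | q x = 0} := hq (measurableSet_singleton 0)
  have hm : Measurable fun x => if q x = 0 then (p x : ℝ≥0∞) else 0 :=
    Measurable.ite hS (by fun_prop) (by fun_prop)
  constructor
  · refine ⟨{x | q x = 0}ᶜ, hS.compl, ?_, ?_⟩
    · rw [withDensity_apply _ hS.compl, setLIntegral_eq_zero_iff hS.compl hm]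
      exact ae_of_all _ fun x hx => if_neg hx
    · rw [compl_compl, withDensity_apply _ hS, setLIntegral_eq_zero_iff hS (by fun_prop)]
      exact ae_of_all _ fun x hx => by simpa using hx
  · rw [← withDensity_mul _ (by fun_prop) (by fun_prop), ← withDensity_add_left hm]
    congr 1
    ext x
    simp only [Pi.add_apply, Pi.mul_apply]
    by_cases h : q x = 0
    · simp [h]
    · rw [if_neg h, zero_add, ← ENNReal.coe_mul, mul_div_cancel₀ _ h]

/-- The divergence as an integral of the perspective of `ψ` against any dominating measure. -/
theorem divg_withDensity {m : Measure X} {ψ : ℝ≥0 → ℝ≥0∞}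
    (hψ : Measurable ψ) (s : ℝ≥0∞) {p q : X → ℝ≥0} (hp : Measurable p) (hq : Measurable q)
    [IsFiniteMeasure (m.withDensity fun x => (q x : ℝ≥0∞))] :
    divg ψ s (m.withDensity fun x => (p x : ℝ≥0∞)) (m.withDensity fun x => (q x : ℝ≥0∞)) =
      ∫⁻ x, persp ψ s (p x) (q x) ∂m := by
  obtain ⟨h1, h2⟩ := lebesgue_withDensity (m := m) hp hq
  have hS : MeasurableSet {x | q x = 0} := hq (measurableSet_singleton 0)
  have hm : Measurable fun x => if q x = 0 then (p x : ℝ≥0∞) else 0 :=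
    Measurable.ite hS (by fun_prop) (by fun_prop)
  have h3 := Measure.eq_singularPart (by fun_prop) h1 h2
  have h4 := Measure.eq_rnDeriv (by fun_prop) h1 h2
  rw [divg, ← h3]
  have h5 : ∫⁻ x, ψ ((m.withDensity fun x => (p x : ℝ≥0∞)).rnDeriv
        (m.withDensity fun x => (q x : ℝ≥0∞)) x).toNNReal ∂(m.withDensity fun x => (q x : ℝ≥0∞))
      = ∫⁻ x, ψ (p x / q x) ∂(m.withDensity fun x => (q x : ℝ≥0∞)) := by
    refine lintegral_congr_ae ?_
    filter_upwards [h4] with x hx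
    rw [← hx, ENNReal.toNNReal_coe]
  rw [h5, lintegral_withDensity_eq_lintegral_mul _ (by fun_prop) (by fun_prop),
    withDensity_apply _ MeasurableSet.univ, Measure.restrict_univ, ← lintegral_const_mul _ hm,
    ← lintegral_add_right _ (hm.const_mul s)]
  refine lintegral_congr fun x => ?_
  by_cases h : q x = 0
  · simp [persp, h, mul_comm]
  · simp [persp, h]

/-- A finite measure dominated by `m` has a density with values in `ℝ≥0`. -/
theorem exists_nnreal_density {P m : Measure X} [IsFiniteMeasure P] [SigmaFinite m] (h : P ≪ m) :
    ∃ p : X → ℝ≥0, Measurable p ∧ P = m.withDensity fun x => (p x : ℝ≥0∞) := by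
  refine ⟨fun x => (P.rnDeriv m x).toNNReal, by fun_prop, ?_⟩
  conv_lhs => rw [← Measure.withDensity_rnDeriv_eq P m h]
  refine withDensity_congr_ae ?_
  filter_upwards [P.rnDeriv_lt_top m] with x hx
  rw [ENNReal.coe_toNNReal hx.ne]

/-- The affine part of the integrand contributes only the total masses. -/
theorem IsNormalization.thetaDiv_eq {θ : ℝ≥0 → EReal} {A B : ℝ} {ψ : ℝ≥0 → ℝ≥0∞} {s : ℝ≥0∞}
    (hn : IsNormalization θ A B ψ s) (P Q : Measure X) [IsFiniteMeasure P] [IsFiniteMeasure Q] :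
    thetaDiv θ X P Q = (divg ψ s P Q : EReal) +
      ((A * P.real Set.univ + B * Q.real Set.univ : ℝ) : EReal) := by
  have hint : Integrable (fun x => (P.rnDeriv Q x).toReal) Q := Measure.integrable_toReal_rnDeriv
  have e1 : extIntegral (fun x => θ (P.rnDeriv Q x).toNNReal) Q =
      ((∫⁻ x, ψ (P.rnDeriv Q x).toNNReal ∂Q : ℝ≥0∞) : EReal) +
        ((∫ x, (A * (P.rnDeriv Q x).toReal + B) ∂Q : ℝ) : EReal) := by
    have hψm := hn.measurable
    rw [← extIntegral_coe_add (f := fun x => ψ (P.rnDeriv Q x).toNNReal)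
      (g := fun x => A * (P.rnDeriv Q x).toReal + B) (by fun_prop) (by fun_prop)
      ((hint.const_mul A).add (integrable_const B))]
    congr 1
    ext x
    rw [hn.eq]
    rfl
  have e2 : ∫ x, (A * (P.rnDeriv Q x).toReal + B) ∂Q =
      A * (∫ x, (P.rnDeriv Q x).toReal ∂Q) + B * Q.real Set.univ := by
    rw [integral_add (hint.const_mul A) (integrable_const B), integral_const_mul, integral_const,
      smul_eq_mul, mul_comm B]
  have e3 : (∫ x, (P.rnDeriv Q x).toReal ∂Q) + (P.singularPart Q).real Set.univ
      = P.real Set.univ := by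
    have h := congrArg (fun μ => Measure.real μ Set.univ) (P.rnDeriv_add_singularPart Q)
    rw [measureReal_add_apply, measureReal_def, withDensity_apply _ MeasurableSet.univ,
      Measure.restrict_univ] at h
    rw [← h, integral_toReal (by fun_prop) (P.rnDeriv_lt_top Q)]
  have e4 : ((P.singularPart Q Set.univ : ℝ≥0∞) : EReal)
      = (((P.singularPart Q).real Set.univ : ℝ) : EReal) := by
    rw [measureReal_def, EReal.coe_ennreal_toReal]
    exact measure_ne_top _ _
  rw [thetaDiv, e1, e2, divg, hn.slope, e4, EReal.right_distrib_of_nonneg_of_ne_top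
    (by exact_mod_cast measureReal_nonneg) (EReal.coe_ne_top _), ← e4, EReal.coe_ennreal_add,
    EReal.coe_ennreal_mul, e4, ← EReal.coe_mul]
  have e5 : ((A * P.real Set.univ + B * Q.real Set.univ : ℝ) : EReal) =
      ((A * (∫ x, (P.rnDeriv Q x).toReal ∂Q) + B * Q.real Set.univ : ℝ) : EReal) +
        ((A * (P.singularPart Q).real Set.univ : ℝ) : EReal) := by
    rw [← EReal.coe_add, ← e3]; congr 1; ring
  rw [e5]
  abel

end Density

/-! ### The adjoint integrand -/

section Adjoint

variable {θ : ℝ≥0 → EReal}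

theorem adjoint_zero : adjoint θ 0 = recessionSlope θ := if_pos rfl

theorem adjoint_of_ne {t : ℝ≥0} (ht : t ≠ 0) : adjoint θ t = ((t : ℝ) : EReal) * θ t⁻¹ := if_neg ht

theorem adjoint_eq_coe (hp : IsProper θ) {t : ℝ≥0} (ht : t ≠ 0) (h : θ t⁻¹ ≠ ⊤) :
    adjoint θ t = ((t * (θ t⁻¹).toReal : ℝ) : EReal) := by
  rw [adjoint_of_ne ht, EReal.coe_mul, hp.coe_toReal h]

theorem ne_top_of_adjoint_ne_top {t : ℝ≥0} (ht : t ≠ 0) (h : adjoint θ t ≠ ⊤) : θ t⁻¹ ≠ ⊤ := by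
  intro h'
  rw [adjoint_of_ne ht, h', EReal.coe_mul_top_of_pos (by positivity)] at h
  exact h rfl

theorem IsStrictlyConvexOnDom.recessionSlope_ne_bot (hc : IsStrictlyConvexOnDom θ)
    (hp : IsProper θ) : recessionSlope θ ≠ ⊥ := by
  obtain ⟨A, B, h⟩ := hc.exists_minorant hp
  exact ((EReal.bot_lt_coe A).trans_le (le_recessionSlope_of_minorant h)).ne'

theorem IsStrictlyConvexOnDom.adjoint_isProper (hc : IsStrictlyConvexOnDom θ) (hp : IsProper θ)
    {z : ℝ≥0} (hz0 : z ≠ 0) (hz : θ z ≠ ⊤) : IsProper (adjoint θ) := by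
  refine ⟨fun t => ?_, z⁻¹, ?_⟩
  · by_cases ht : t = 0
    · rw [ht, adjoint_zero]
      exact hc.recessionSlope_ne_bot hp
    · by_cases h : θ t⁻¹ = ⊤
      · rw [adjoint_of_ne ht, h, EReal.coe_mul_top_of_pos (by positivity)]
        exact top_ne_bot
      · rw [adjoint_eq_coe hp ht h]
        exact EReal.coe_ne_bot _
  · rw [adjoint_eq_coe hp (inv_ne_zero hz0) (by rwa [inv_inv])]
    exact EReal.coe_ne_top _

theorem IsStrictlyConvexOnDom.adjoint (hc : IsStrictlyConvexOnDom θ) (hp : IsProper θ) :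
    IsStrictlyConvexOnDom (adjoint θ) := by
  intro x y hx hy hxy a b ha hb hab
  wlog hlt : x < y generalizing x y a b
  · have := this y x hy hx hxy.symm b a hb ha (by rwa [add_comm])
      (lt_of_le_of_ne (not_lt.1 hlt) hxy.symm)
    rwa [add_comm (b * y), add_comm (((b : ℝ) : EReal) * _)] at this
  have hy0 : y ≠ 0 := (pos_of_gt hlt).ne'
  have hyt := ne_top_of_adjoint_ne_top hy0 hy
  have hab' : (a : ℝ) + b = 1 := by exact_mod_cast hab
  have ha' : (0 : ℝ) < a := ha
  have hb' : (0 : ℝ) < b := hb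
  have hy' : (0 : ℝ) < y := by positivity
  rw [adjoint_eq_coe hp hy0 hyt]
  -- At the endpoint `0` the claim says that chords are less steep than the recession slope.
  by_cases hx0 : x = 0
  · subst hx0
    rw [adjoint_zero] at hx ⊢
    lift recessionSlope θ to ℝ using ⟨hx, hc.recessionSlope_ne_bot hp⟩ with R hR
    have hzw : y⁻¹ < (b * y)⁻¹ := by
      refine inv_strictAnti₀ (by positivity) ?_
      rw [← NNReal.coe_lt_coe]; push_cast; nlinarith
    have hct : θ (b * y)⁻¹ ≠ ⊤ := hc.ne_top_of_recessionSlope hp (by rw [← hR]; simp) hzw.le hyt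
    have h := hc.lt_recession hp hR.symm hzw hyt
    rw [mul_zero, zero_add, adjoint_eq_coe hp (by positivity) hct, ← EReal.coe_mul, ← EReal.coe_mul,
      ← EReal.coe_add, EReal.coe_lt_coe_iff]
    have h2 := mul_lt_mul_of_pos_left h (show (0 : ℝ) < b * y by positivity)
    push_cast at h2 ⊢
    refine h2.trans_eq ?_
    field_simp
    linear_combination (-R) * hab'
  · have hxt := ne_top_of_adjoint_ne_top hx0 hx
    have hx' : (0 : ℝ) < x := by positivity
    have hlt' : (x : ℝ) < y := hlt
    have h1 : y⁻¹ < (a * x + b * y)⁻¹ := by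
      refine inv_strictAnti₀ (by positivity) ?_
      rw [← NNReal.coe_lt_coe]; push_cast; nlinarith
    have h2 : (a * x + b * y)⁻¹ < x⁻¹ := by
      refine inv_strictAnti₀ (by positivity) ?_
      rw [← NNReal.coe_lt_coe]; push_cast; nlinarith
    obtain ⟨hct, h⟩ := hc.three_point hp h1 h2 hyt hxt
    rw [adjoint_eq_coe hp (by positivity) hct, adjoint_eq_coe hp hx0 hxt, ← EReal.coe_mul,
      ← EReal.coe_mul, ← EReal.coe_add, EReal.coe_lt_coe_iff]
    generalize (θ (a * x + b * y)⁻¹).toReal = fc at *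
    generalize (θ x⁻¹).toReal = fx at *
    generalize (θ y⁻¹).toReal = fy at *
    push_cast at h ⊢
    have hcpos : (0 : ℝ) < a * x + b * y := by positivity
    have hb1 : (b : ℝ) = 1 - a := by linarith
    generalize hcd : (a : ℝ) * x + b * y = c at *
    have h3 := mul_lt_mul_of_pos_left h (show (0 : ℝ) < c * x * y by positivity)
    have e1 : c * x * y * (((x : ℝ)⁻¹ - (y : ℝ)⁻¹) * fc) = (y - x) * (c * fc) := by
      field_simp
    have e2 : c * x * y * (((x : ℝ)⁻¹ - c⁻¹) * fy + (c⁻¹ - (y : ℝ)⁻¹) * fx) =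
        (c - x) * (y * fy) + (y - c) * (x * fx) := by
      field_simp
    have e3 : c - x = b * (y - x) := by rw [← hcd, hb1]; ring
    have e4 : (y : ℝ) - c = a * (y - x) := by rw [← hcd, hb1]; ring
    rw [e1, e2, e3, e4] at h3
    refine lt_of_mul_lt_mul_left (h3.trans_eq ?_) (show (0 : ℝ) ≤ y - x by linarith)
    ring

/-- The upper limit in the definition of the recession slope is also a lower limit. -/
theorem IsStrictlyConvexOnDom.eventually_lt_div (hc : IsStrictlyConvexOnDom θ) (hp : IsProper θ)
    {y : EReal} (hy : y < recessionSlope θ) :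
    ∀ᶠ v : ℝ≥0 in atTop, y < θ v / ((v : ℝ) : EReal) := by
  obtain ⟨z, hz⟩ := hp.2
  obtain ⟨K, hyK, hK⟩ := EReal.lt_iff_exists_real_btwn.1 hy
  obtain ⟨K₁, hK₁, hK₂⟩ := EReal.lt_iff_exists_real_btwn.1 hK
  have hKK : K < K₁ := EReal.coe_lt_coe_iff.1 hK₁
  -- For large `w`, the inequality `K₁ w < θ w` makes the chord from `z` to `w` steeper than `K`.
  have hfr : ∃ᶠ w : ℝ≥0 in atTop, (K₁ : EReal) < θ w / ((w : ℝ) : EReal) :=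
    frequently_lt_of_lt_limsup (by isBoundedDefault) hK₂
  have hlarge : ∀ᶠ w : ℝ≥0 in atTop, ((θ z).toReal - K * z) / (K₁ - K) ≤ (w : ℝ) :=
    (NNReal.tendsto_coe_atTop.2 tendsto_id).eventually (eventually_ge_atTop _)
  obtain ⟨w, hw1, hw2, hw3, hw4⟩ := (hfr.and_eventually ((eventually_gt_atTop z).and
    ((eventually_gt_atTop 0).and hlarge))).exists
  have hw0 : (0 : ℝ) < w := hw3
  rw [EReal.lt_div_iff (by exact_mod_cast hw0) (EReal.coe_ne_top _), ← EReal.coe_mul] at hw1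
  rw [div_le_iff₀ (by linarith)] at hw4
  refine Refinement.eventually_lt_div (C := (θ z).toReal - K * z) (w := w) hyK fun v hv => ?_
  have hgr : (((θ z).toReal + K * (w - z) : ℝ) : EReal) ≤ θ w := by
    refine le_trans ?_ hw1.le
    rw [EReal.coe_le_coe_iff]
    linarith
  convert hc.growth hp hw2 hz hgr hv using 2
  ring

/-- At `0`, lower semicontinuity holds because `t θ(1 / t)` tends to the recession slope as
`t → 0`. -/
theorem IsStrictlyConvexOnDom.adjoint_lowerSemicontinuous (hc : IsStrictlyConvexOnDom θ)
    (hp : IsProper θ) (hl : LowerSemicontinuous θ) :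
    LowerSemicontinuous (Refinement.adjoint θ) := by
  intro t y hy
  by_cases ht : t = 0
  · subst ht
    rw [adjoint_zero] at hy
    have hev := tendsto_inv_nhdsGT_zero (𝕜 := ℝ≥0) |>.eventually (hc.eventually_lt_div hp hy)
    rw [eventually_nhdsWithin_iff] at hev
    filter_upwards [hev] with x hx
    by_cases hx0 : x = 0
    · rwa [hx0, adjoint_zero]
    · have := hx (pos_iff_ne_zero.2 hx0)
      rw [adjoint_of_ne hx0, mul_comm]
      rwa [EReal.div_eq_inv_mul, ← EReal.coe_inv, NNReal.coe_inv, inv_inv, mul_comm] at this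
  · rw [adjoint_of_ne ht] at hy
    have ht' : (0 : ℝ) < t := by positivity
    obtain ⟨K, hyK, hK⟩ := EReal.lt_iff_exists_real_btwn.1 hy
    have hK' : ((K / t : ℝ) : EReal) < θ t⁻¹ := by
      rw [EReal.coe_div]
      rw [mul_comm] at hK
      exact (EReal.div_lt_iff (by exact_mod_cast ht') (EReal.coe_ne_top _)).2 hK
    obtain ⟨L, hL1, hL2⟩ := EReal.lt_iff_exists_real_btwn.1 hK'
    have hL : K < t * L := by
      have := (div_lt_iff₀ ht').1 (EReal.coe_lt_coe_iff.1 hL1)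
      linarith
    have hcont : Tendsto (fun x : ℝ≥0 => (x : ℝ) * L) (nhds t) (nhds ((t : ℝ) * L)) :=
      ((NNReal.continuous_coe.tendsto t).mul_const L)
    filter_upwards [(tendsto_inv₀ ht).eventually (hl _ _ hL2), hcont.eventually (lt_mem_nhds hL),
      eventually_ne_nhds ht] with x hx1 hx2 hx3
    rw [adjoint_of_ne hx3]
    have hx' : (0 : ℝ) < x := by positivity
    calc y < (K : EReal) := hyK
      _ < ((x * L : ℝ) : EReal) := EReal.coe_lt_coe_iff.2 hx2
      _ = ((x : ℝ) : EReal) * (L : EReal) := EReal.coe_mul _ _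
      _ ≤ _ := mul_le_mul_of_nonneg_left hx1.le (by exact_mod_cast hx'.le)

/-- The recession slope of the adjoint is `θ(0)`. A point of the domain other than `0` is needed:
the adjoint of an integrand with domain `{0}` is infinite on `(0, ∞)`. -/
theorem IsStrictlyConvexOnDom.recessionSlope_adjoint (hc : IsStrictlyConvexOnDom θ)
    (hp : IsProper θ) (hl : LowerSemicontinuous θ) {z : ℝ≥0} (hz0 : z ≠ 0) (hz : θ z ≠ ⊤) :
    recessionSlope (Refinement.adjoint θ) = θ 0 := by
  have hinv : Tendsto (fun t : ℝ≥0 => t⁻¹) atTop (nhds 0) := tendsto_inv_atTop_zero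
  suffices h : Tendsto (fun t : ℝ≥0 => θ t⁻¹) atTop (nhds (θ 0)) by
    rw [recessionSlope, ← h.limsup_eq]
    refine limsup_congr ?_
    filter_upwards [eventually_gt_atTop 0] with t ht
    have ht' : (0 : ℝ) < t := ht
    rw [adjoint_of_ne ht.ne', mul_comm, ← EReal.mul_div, EReal.div_self (by simp) (by simp) (by
      exact_mod_cast ht'.ne'), mul_one]
  refine tendsto_order.2 ⟨fun y hy => hinv.eventually (hl 0 y hy), fun y hy => ?_⟩
  have h0 : θ 0 ≠ ⊤ := hy.ne_top
  rw [← hp.coe_toReal h0] at hy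
  have hz' : (0 : ℝ) < z := by positivity
  have hlim : Tendsto (fun t : ℝ≥0 => (((z - (t⁻¹ : ℝ≥0)) / z * (θ 0).toReal
      + (t⁻¹ : ℝ≥0) / z * (θ z).toReal : ℝ) : EReal)) atTop (nhds ((θ 0).toReal : EReal)) := by
    have h := (NNReal.continuous_coe.tendsto 0).comp hinv
    refine (continuous_coe_real_ereal.tendsto _).comp ?_
    have h2 := (((tendsto_const_nhds (x := (z : ℝ))).sub h).div_const (z : ℝ)).mul_const
      (θ 0).toReal |>.add ((h.div_const (z : ℝ)).mul_const (θ z).toReal)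
    simpa [hz'.ne'] using h2
  filter_upwards [hlim.eventually (gt_mem_nhds hy), hinv.eventually (gt_mem_nhds
    (pos_iff_ne_zero.2 hz0)), eventually_gt_atTop 0] with t h1 h2 h3
  obtain ⟨hct, h⟩ := hc.three_point hp (inv_pos.2 h3) h2 h0 hz
  refine lt_of_le_of_lt ?_ h1
  rw [← hp.coe_toReal hct, EReal.coe_le_coe_iff, div_mul_eq_mul_div, div_mul_eq_mul_div, ← add_div,
    le_div_iff₀ hz']
  simp only [NNReal.coe_zero, sub_zero] at h
  linarith

/-- The normalization of the adjoint integrand exchanges the two affine coefficients, and the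
values at zero and at infinity. -/
theorem IsNormalization.adjoint {A B : ℝ} {ψ : ℝ≥0 → ℝ≥0∞} {s : ℝ≥0∞}
    (hn : IsNormalization θ A B ψ s) (hr : recessionSlope (Refinement.adjoint θ) = θ 0) :
    IsNormalization (Refinement.adjoint θ) B A (fun t => if t = 0 then s else t * ψ t⁻¹) (ψ 0) := by
  have hψ := hn.measurable
  refine ⟨Measurable.ite (measurableSet_singleton 0) measurable_const (by fun_prop),
    fun t => ?_, ?_⟩
  · by_cases ht : t = 0
    · simp [ht, adjoint_zero, hn.slope]
    · have ht' : (0 : ℝ) < t := by positivity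
      rw [adjoint_of_ne ht, hn.eq, if_neg ht, EReal.left_distrib_of_nonneg_of_ne_top
        (by exact_mod_cast ht'.le) (EReal.coe_ne_top _), ← EReal.coe_mul, EReal.coe_ennreal_mul]
      congr 2
      push_cast
      field_simp
      ring
  · rw [hr, hn.eq]
    simp

theorem persp_adjoint (ψ : ℝ≥0 → ℝ≥0∞) (s : ℝ≥0∞) (p q : ℝ≥0) :
    persp (fun t => if t = 0 then s else t * ψ t⁻¹) (ψ 0) q p = persp ψ s p q := by
  by_cases hp : p = 0 <;> by_cases hq : q = 0 <;> simp [persp, hp, hq]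
  rw [← mul_assoc, ENNReal.mul_div_cancel (by simpa using hp) (by simp)]

/-- Exchanging the two measures amounts to passing to the adjoint integrand. -/
theorem thetaDiv_adjoint (hc : IsStrictlyConvexOnDom θ) (hp : IsProper θ)
    (hl : LowerSemicontinuous θ) {z : ℝ≥0} (hz0 : z ≠ 0) (hz : θ z ≠ ⊤) {X : Type u}
    [MeasurableSpace X] (P Q : Measure X) [IsFiniteMeasure P] [IsFiniteMeasure Q] :
    thetaDiv θ X P Q = thetaDiv (Refinement.adjoint θ) X Q P := by
  obtain ⟨A, B, h⟩ := hc.exists_minorant hp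
  obtain ⟨ψ, s, hn⟩ := exists_isNormalization hl.measurable h
  have hn' := hn.adjoint (hc.recessionSlope_adjoint hp hl hz0 hz)
  rw [hn.thetaDiv_eq, hn'.thetaDiv_eq, add_comm (A * _)]
  congr 2
  obtain ⟨p, hpm, hP⟩ := exists_nnreal_density (P := P) (m := P + Q)
    (Measure.AbsolutelyContinuous.rfl.add_right _)
  obtain ⟨q, hqm, hQ⟩ := exists_nnreal_density (P := Q) (m := P + Q)
    (by rw [add_comm]; exact Measure.AbsolutelyContinuous.rfl.add_right _)
  generalize P + Q = m at hP hQ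
  subst hP hQ
  rw [divg_withDensity hn.measurable _ hpm hqm, divg_withDensity hn'.measurable _ hqm hpm]
  exact lintegral_congr fun x => (persp_adjoint ψ s _ _).symm

end Adjoint

/-! ### Jensen's inequality and projection to a marginal -/

section Jensen

variable {θ : ℝ≥0 → EReal} {A B : ℝ} {ψ : ℝ≥0 → ℝ≥0∞} {s : ℝ≥0∞}

theorem persp_ne_top_iff_of_ne {p q : ℝ≥0} (hq : q ≠ 0) : persp ψ s p q ≠ ⊤ ↔ ψ (p / q) ≠ ⊤ := by
  simp [persp, hq, ENNReal.mul_eq_top]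

/-- A supporting line of `θ` at `c` gives a linear minorant of the perspective that touches it
exactly along the ray `p = c q`. -/
theorem IsNormalization.linear_lt_persp (hn : IsNormalization θ A B ψ s)
    (hc : IsStrictlyConvexOnDom θ) (hp : IsProper θ) {A' B' : ℝ} {c : ℝ≥0}
    (hcc : θ c = ((A' * c + B' : ℝ) : EReal))
    (h : ∀ x, x ≠ c → ((A' * x + B' : ℝ) : EReal) < θ x) {p q : ℝ≥0} (hpq : p ≠ c * q)
    (hfin : persp ψ s p q ≠ ⊤) : (A' - A) * p + (B' - B) * q < (persp ψ s p q).toReal := by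
  by_cases hq : q = 0
  · subst hq
    have hp0 : p ≠ 0 := by simpa using hpq
    have hp' : (0 : ℝ) < p := by positivity
    simp only [persp, if_true] at hfin ⊢
    have hs : s ≠ ⊤ := fun hs => hfin (by rw [hs, ENNReal.mul_top (by simpa using hp0)])
    have h1 := hc.support_lt_recessionSlope hp hcc h
    rw [hn.slope_toReal hs, EReal.coe_lt_coe_iff] at h1
    rw [ENNReal.toReal_mul, ENNReal.coe_toReal]
    push_cast
    nlinarith
  · have hq' : (0 : ℝ) < q := by positivity
    have hx : p / q ≠ c := fun hx => hpq (by rw [← hx, div_mul_cancel₀ _ hq])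
    have hψ := (persp_ne_top_iff_of_ne hq).1 hfin
    have hθ := hn.ne_top_iff.1 hψ
    have h1 := h _ hx
    rw [← hp.coe_toReal hθ, EReal.coe_lt_coe_iff, hn.toReal hθ] at h1
    have h2 := mul_lt_mul_of_pos_left h1 hq'
    rw [persp, if_neg hq, ENNReal.toReal_mul, ENNReal.coe_toReal]
    push_cast at h2
    have e : (q : ℝ) * (p / q) = p := by field_simp
    have h3 : A' * (q * (p / q)) + q * B' <
        q * (ψ (p / q)).toReal + (A * (q * (p / q)) + q * B) := by
      linarith
    rw [e] at h3
    linarith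

theorem IsNormalization.persp_eq_linear (hn : IsNormalization θ A B ψ s)
    {A' B' : ℝ} {c : ℝ≥0} (hcc : θ c = ((A' * c + B' : ℝ) : EReal)) {p q : ℝ≥0}
    (hpq : p = c * q) : persp ψ s p q ≠ ⊤ ∧
      (persp ψ s p q).toReal = (A' - A) * p + (B' - B) * q := by
  have hct : θ c ≠ ⊤ := by rw [hcc]; exact EReal.coe_ne_top _
  have h1 := hn.toReal hct
  rw [hcc, EReal.toReal_coe] at h1
  by_cases hq : q = 0
  · subst hq
    simp [persp, hpq]
  · have hpc : p / q = c := by rw [hpq, mul_div_cancel_right₀ _ hq]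
    refine ⟨(persp_ne_top_iff_of_ne hq).2 (by rw [hpc]; exact hn.ne_top_iff.2 hct), ?_⟩
    rw [persp, if_neg hq, ENNReal.toReal_mul, ENNReal.coe_toReal, hpc, hpq]
    push_cast
    linear_combination (-(q : ℝ)) * h1

/-- A finite perspective above the ray of slope `c` provides a point of the domain above `c`; when
`q = 0` it is the recession slope that is finite, and the domain is unbounded. -/
theorem IsNormalization.exists_dom_gt (hn : IsNormalization θ A B ψ s)
    (hc : IsStrictlyConvexOnDom θ) (hp : IsProper θ) {x c : ℝ≥0} (hx : θ x ≠ ⊤) (hxc : x < c)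
    {p q : ℝ≥0} (hpq : c * q < p) (hfin : persp ψ s p q ≠ ⊤) : ∃ y, c < y ∧ θ y ≠ ⊤ := by
  by_cases hq : q = 0
  · subst hq
    have hp0 : p ≠ 0 := (pos_of_gt hpq).ne'
    simp only [persp, if_true] at hfin
    have hs : s ≠ ⊤ := fun hs => hfin (by rw [hs, ENNReal.mul_top (by simpa using hp0)])
    exact ⟨c + 1, lt_add_one c, hc.ne_top_of_recessionSlope hp (hn.slope_ne_top_iff.1 hs)
      (hxc.le.trans (lt_add_one c).le) hx⟩
  · exact ⟨p / q, (lt_div_iff₀ (pos_iff_ne_zero.2 hq)).2 hpq,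
      hn.ne_top_iff.1 ((persp_ne_top_iff_of_ne hq).1 hfin)⟩

/-- Jensen's inequality for the perspective, with its equality case: unless the density is almost
surely constant, the inequality is strict. -/
theorem IsNormalization.jensen (hn : IsNormalization θ A B ψ s) (hc : IsStrictlyConvexOnDom θ)
    (hp : IsProper θ) {X : Type*} [MeasurableSpace X] {κ : Measure X} [IsProbabilityMeasure κ]
    {p q : X → ℝ≥0} (hpm : Measurable p) (hqm : Measurable q) (hpq : ∀ x, p x + q x = 1)
    {p' q' : ℝ≥0} (hp' : (p' : ℝ≥0∞) = ∫⁻ x, p x ∂κ) (hq' : (q' : ℝ≥0∞) = ∫⁻ x, q x ∂κ)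
    (hfin : ∫⁻ x, persp ψ s (p x) (q x) ∂κ ≠ ⊤) :
    (∀ᵐ x ∂κ, p x = p' ∧ q x = q') ∨ persp ψ s p' q' < ∫⁻ x, persp ψ s (p x) (q x) ∂κ := by
  have hpers := measurable_persp hn.measurable s hpm hqm
  have hsum : p' + q' = 1 := by
    have : ((p' + q' : ℝ≥0) : ℝ≥0∞) = 1 := by
      rw [ENNReal.coe_add, hp', hq', ← lintegral_add_left (by fun_prop)]
      simp [← ENNReal.coe_add, hpq]
    exact_mod_cast this
  have hpq' : ∀ x, (p x : ℝ) + q x = 1 := fun x => by exact_mod_cast hpq x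
  have hsum' : (p' : ℝ) + q' = 1 := by exact_mod_cast hsum
  have hbd : ∀ x, (q x : ℝ) ≤ 1 := fun x => by linarith [hpq' x, (p x).coe_nonneg]
  have hbd' : ∀ x, (p x : ℝ) ≤ 1 := fun x => by linarith [hpq' x, (q x).coe_nonneg]
  have hqi : Integrable (fun x => (q x : ℝ)) κ :=
    Integrable.of_bound (by fun_prop) 1 (ae_of_all _ fun x => by simpa using hbd x)
  have hpi : Integrable (fun x => (p x : ℝ)) κ :=
    Integrable.of_bound (by fun_prop) 1 (ae_of_all _ fun x => by simpa using hbd' x)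
  have hqint : ∫ x, (q x : ℝ) ∂κ = q' := by
    rw [integral_eq_lintegral_of_nonneg_ae (ae_of_all _ fun x => (q x).coe_nonneg) (by fun_prop)]
    simp [← hq']
  have hpint : ∫ x, (p x : ℝ) ∂κ = p' := by
    rw [integral_eq_lintegral_of_nonneg_ae (ae_of_all _ fun x => (p x).coe_nonneg) (by fun_prop)]
    simp [← hp']
  by_cases hconst : ∀ᵐ x ∂κ, q x = q'
  · left
    filter_upwards [hconst] with x hx
    refine ⟨?_, hx⟩
    have := (hpq x).trans hsum.symm
    rwa [hx, add_left_inj] at this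
  right
  have hae : ∀ᵐ x ∂κ, persp ψ s (p x) (q x) < ⊤ := ae_lt_top hpers hfin
  -- The density takes values on both sides of its mean.
  have h1 : ∃ x, q' < q x ∧ persp ψ s (p x) (q x) ≠ ⊤ := by
    by_contra hcon
    push Not at hcon
    refine hconst ?_
    have hle : ∀ᵐ x ∂κ, 0 ≤ (q' : ℝ) - q x := by
      filter_upwards [hae] with x hx
      have : q x ≤ q' := not_lt.1 fun h => hx.ne (hcon x h)
      exact sub_nonneg.2 (by exact_mod_cast this)
    have h0 : ∫ x, ((q' : ℝ) - q x) ∂κ = 0 := by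
      rw [integral_sub (integrable_const _) hqi, hqint]; simp
    filter_upwards [(integral_eq_zero_iff_of_nonneg_ae hle ((integrable_const _).sub hqi)).1 h0]
      with x hx
    have : (q' : ℝ) - q x = 0 := hx
    exact_mod_cast (sub_eq_zero.1 this).symm
  have h2 : ∃ x, q x < q' ∧ persp ψ s (p x) (q x) ≠ ⊤ := by
    by_contra hcon
    push Not at hcon
    refine hconst ?_
    have hle : ∀ᵐ x ∂κ, 0 ≤ (q x : ℝ) - q' := by
      filter_upwards [hae] with x hx
      have : q' ≤ q x := not_lt.1 fun h => hx.ne (hcon x h)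
      exact sub_nonneg.2 (by exact_mod_cast this)
    have h0 : ∫ x, ((q x : ℝ) - q') ∂κ = 0 := by
      rw [integral_sub hqi (integrable_const _), hqint]; simp
    filter_upwards [(integral_eq_zero_iff_of_nonneg_ae hle (hqi.sub (integrable_const _))).1 h0]
      with x hx
    have : (q x : ℝ) - q' = 0 := hx
    exact_mod_cast (sub_eq_zero.1 this)
  obtain ⟨x₁, hx₁, hf₁⟩ := h1
  obtain ⟨x₂, hx₂, hf₂⟩ := h2
  have hq'0 : q' ≠ 0 := (pos_of_gt hx₂).ne'
  have hq1 : q x₁ ≠ 0 := (pos_of_gt hx₁).ne'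
  have hq'pos : (0 : ℝ) < q' := by positivity
  have hx₁' : (q' : ℝ) < q x₁ := hx₁
  have hx₂' : (q x₂ : ℝ) < q' := hx₂
  set c : ℝ≥0 := p' / q' with hcdef
  have hcq : (c : ℝ) * q' = p' := by rw [hcdef]; push_cast; field_simp
  have hlt₁ : p x₁ / q x₁ < c := by
    rw [hcdef, div_lt_div_iff₀ (pos_iff_ne_zero.2 hq1) (pos_iff_ne_zero.2 hq'0),
      ← NNReal.coe_lt_coe]
    push_cast
    nlinarith [hpq' x₁]
  have hdom₁ := hn.ne_top_iff.1 ((persp_ne_top_iff_of_ne hq1).1 hf₁)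
  have hc0 : (0 : ℝ) ≤ c := c.coe_nonneg
  obtain ⟨y, hcy, hy⟩ := hn.exists_dom_gt hc hp hdom₁ hlt₁ (p := p x₂) (q := q x₂) (by
    rw [← NNReal.coe_lt_coe]
    push_cast
    nlinarith [hpq' x₂]) hf₂
  obtain ⟨A', B', hcc, hsup⟩ := hc.exists_support hp hlt₁ hcy hdom₁ hy
  obtain ⟨hpt, hpeq⟩ := hn.persp_eq_linear hcc (p := p') (q := q') (by
    rw [← NNReal.coe_inj]; push_cast; exact hcq.symm)
  have hle : ∀ᵐ x ∂κ, (A' - A) * p x + (B' - B) * q x ≤ (persp ψ s (p x) (q x)).toReal := by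
    filter_upwards [hae] with x hx
    by_cases h : p x = c * q x
    · exact (hn.persp_eq_linear hcc h).2.ge
    · exact (hn.linear_lt_persp hc hp hcc hsup h hx.ne).le
  have hFi : Integrable (fun x => (persp ψ s (p x) (q x)).toReal) κ :=
    integrable_toReal_of_lintegral_ne_top hpers.aemeasurable hfin
  have hli : Integrable (fun x => (A' - A) * (p x : ℝ) + (B' - B) * q x) κ :=
    (hpi.const_mul _).add (hqi.const_mul _)
  have hlint : ∫ x, ((A' - A) * (p x : ℝ) + (B' - B) * q x) ∂κ = (A' - A) * p' + (B' - B) * q' := by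
    rw [integral_add (hpi.const_mul _) (hqi.const_mul _), integral_const_mul, integral_const_mul,
      hpint, hqint]
  rw [← ENNReal.toReal_lt_toReal hpt hfin, hpeq, ← integral_toReal hpers.aemeasurable hae, ← hlint]
  refine lt_of_le_of_ne (integral_mono_ae hli hFi hle) fun heq => hconst ?_
  have hdiff : ∫ x, ((persp ψ s (p x) (q x)).toReal -
      ((A' - A) * (p x : ℝ) + (B' - B) * q x)) ∂κ = 0 := by
    rw [integral_sub hFi hli, heq, sub_self]
  have hz := (integral_eq_zero_iff_of_nonneg_ae (by
    filter_upwards [hle] with x hx using sub_nonneg.2 hx) (hFi.sub hli)).1 hdiff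
  filter_upwards [hz, hae] with x hx hxt
  have hx0 : (persp ψ s (p x) (q x)).toReal - ((A' - A) * (p x : ℝ) + (B' - B) * q x) = 0 := hx
  have hray : p x = c * q x := by
    by_contra h
    linarith [hn.linear_lt_persp hc hp hcc hsup h hxt.ne]
  have hray' : (p x : ℝ) = c * q x := by exact_mod_cast hray
  have h4 : ((c : ℝ) + 1) * q x = (c + 1) * q' := by linarith [hpq' x]
  exact_mod_cast mul_left_cancel₀ (by positivity) h4

end Jensen

section Projection

/-- A measure below a finite measure `M` has a density that is everywhere at most one. -/
theorem exists_density_le_one {Z : Type*} [MeasurableSpace Z] {Q M : Measure Z} [IsFiniteMeasure M]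
    (hle : Q ≤ M) : ∃ q : Z → ℝ≥0, Measurable q ∧ (∀ z, q z ≤ 1) ∧
      Q = M.withDensity (fun z => (q z : ℝ≥0∞)) := by
  have : IsFiniteMeasure Q := isFiniteMeasure_of_le M hle
  refine ⟨fun z => min (Q.rnDeriv M z).toNNReal 1, by fun_prop, fun z => min_le_right _ _, ?_⟩
  conv_lhs => rw [← Measure.withDensity_rnDeriv_eq Q M hle.absolutelyContinuous]
  refine withDensity_congr_ae ?_
  filter_upwards [Measure.rnDeriv_le_one_of_le hle] with z hz
  have hz' : (Q.rnDeriv M z).toNNReal ≤ 1 := by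
    simpa using ENNReal.toNNReal_mono ENNReal.one_ne_top hz
  rw [min_eq_left hz', ENNReal.coe_toNNReal (ne_top_of_le_ne_top ENNReal.one_ne_top hz)]

theorem measure_add_right_cancel {Z : Type*} [MeasurableSpace Z] {a b c : Measure Z}
    [IsFiniteMeasure c] (h : a + c = b + c) : a = b := by
  ext t ht
  have h := congrArg (fun μ => μ t) h
  simp only [Measure.add_apply] at h
  exact (ENNReal.add_left_inj (measure_ne_top c t)).1 h

/-- Two finite measures have densities with respect to their sum that add up to one. -/
theorem exists_density_pair {Z : Type*} [MeasurableSpace Z] (P Q : Measure Z) [IsFiniteMeasure P]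
    [IsFiniteMeasure Q] : ∃ p q : Z → ℝ≥0, Measurable p ∧ Measurable q ∧ (∀ z, p z + q z = 1) ∧
      P = (P + Q).withDensity (fun z => (p z : ℝ≥0∞)) ∧
      Q = (P + Q).withDensity (fun z => (q z : ℝ≥0∞)) := by
  obtain ⟨q, hqm, hq1, hQ⟩ := exists_density_le_one (Q := Q) (M := P + Q)
    (Measure.le_add_left le_rfl)
  refine ⟨fun z => 1 - q z, q, by fun_prop, hqm, fun z => tsub_add_cancel_of_le (hq1 z), ?_, hQ⟩
  have hadd : (P + Q).withDensity (fun z => ((1 - q z : ℝ≥0) : ℝ≥0∞)) +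
      (P + Q).withDensity (fun z => (q z : ℝ≥0∞)) = P + Q := by
    rw [← withDensity_add_left (by fun_prop)]
    have : (fun z => ((1 - q z : ℝ≥0) : ℝ≥0∞)) + (fun z => (q z : ℝ≥0∞)) = 1 := by
      ext z
      simp only [Pi.add_apply, ← ENNReal.coe_add, Pi.one_apply]
      rw [tsub_add_cancel_of_le (hq1 z), ENNReal.coe_one]
    rw [this, withDensity_one]
  rw [← hQ] at hadd
  exact (measure_add_right_cancel hadd).symm

variable {X Y : Type u} [MeasurableSpace X] [MeasurableSpace Y]

theorem compProd_withDensity_fst (μ : Measure Y) [SFinite μ] (κ : Kernel Y X) [IsSFiniteKernel κ]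
    {f : Y → ℝ≥0} (hf : Measurable f) :
    (μ ⊗ₘ κ).withDensity (fun z => (f z.1 : ℝ≥0∞)) =
      (μ.withDensity fun y => (f y : ℝ≥0∞)) ⊗ₘ κ := by
  ext t ht
  rw [withDensity_apply _ ht, ← lintegral_indicator ht, Measure.lintegral_compProd
    (Measurable.indicator (by fun_prop) ht), Measure.compProd_apply ht,
    lintegral_withDensity_eq_lintegral_mul _ (by fun_prop)
      (Kernel.measurable_kernel_prodMk_left ht)]
  refine lintegral_congr fun y => ?_
  have : ∀ x, t.indicator (fun z : Y × X => (f z.1 : ℝ≥0∞)) (y, x) =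
      (Prod.mk y ⁻¹' t).indicator (fun _ => (f y : ℝ≥0∞)) x := fun x => rfl
  simp only [this]
  rw [lintegral_indicator_const (measurable_prodMk_left ht)]
  rfl

theorem fst_withDensity_compProd (μ : Measure Y) [SFinite μ] (κ : Kernel Y X) [IsSFiniteKernel κ]
    {f : Y × X → ℝ≥0} (hf : Measurable f) :
    ((μ ⊗ₘ κ).withDensity (fun z => (f z : ℝ≥0∞))).fst =
      μ.withDensity fun y => ∫⁻ x, f (y, x) ∂κ y := by
  ext t ht
  rw [Measure.fst_apply ht, withDensity_apply _ (measurable_fst ht), withDensity_apply _ ht,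
    ← lintegral_indicator (measurable_fst ht), Measure.lintegral_compProd
    (Measurable.indicator (by fun_prop) (measurable_fst ht)), ← lintegral_indicator ht]
  refine lintegral_congr fun y => ?_
  by_cases hy : y ∈ t <;> simp [Set.indicator, hy]

/-- Forgetting the second coordinate does not increase the divergence, and if the divergence stays
the same then both measures share their conditional law given the first coordinate. -/
theorem IsNormalization.divg_fst {θ : ℝ≥0 → EReal} {A B : ℝ} {ψ : ℝ≥0 → ℝ≥0∞} {s : ℝ≥0∞}
    (hn : IsNormalization θ A B ψ s) (hc : IsStrictlyConvexOnDom θ) (hp : IsProper θ)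
    [StandardBorelSpace X] [Nonempty X] (π π' : Measure (Y × X)) [IsFiniteMeasure π]
    [IsFiniteMeasure π'] :
    divg ψ s π.fst π'.fst ≤ divg ψ s π π' ∧
      (divg ψ s π π' ≠ ⊤ → divg ψ s π π' ≤ divg ψ s π.fst π'.fst →
        ∃ κ : Kernel Y X, IsMarkovKernel κ ∧ π = π.fst ⊗ₘ κ ∧ π' = π'.fst ⊗ₘ κ) := by
  by_cases hfin : divg ψ s π π' = ⊤
  · rw [hfin]
    exact ⟨le_top, fun h => (h rfl).elim⟩
  obtain ⟨p, q, hpm, hqm, hpq, hπ, hπ'⟩ := exists_density_pair π π'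
  obtain ⟨m, hm⟩ : ∃ m, m = π + π' := ⟨_, rfl⟩
  have : IsFiniteMeasure m := by rw [hm]; infer_instance
  rw [← hm] at hπ hπ'
  have hdis : m.fst ⊗ₘ m.condKernel = m := m.disintegrate _
  set κ := m.condKernel
  set p' : Y → ℝ≥0 := fun y => (∫⁻ x, p (y, x) ∂κ y).toNNReal
  set q' : Y → ℝ≥0 := fun y => (∫⁻ x, q (y, x) ∂κ y).toNNReal
  have hp'm : Measurable p' :=
    (Measurable.lintegral_kernel_prod_right' (f := fun z : Y × X => (p z : ℝ≥0∞))
      (by fun_prop)).ennreal_toNNReal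
  have hq'm : Measurable q' :=
    (Measurable.lintegral_kernel_prod_right' (f := fun z : Y × X => (q z : ℝ≥0∞))
      (by fun_prop)).ennreal_toNNReal
  have hp' : ∀ y, (p' y : ℝ≥0∞) = ∫⁻ x, p (y, x) ∂κ y := fun y => by
    refine ENNReal.coe_toNNReal (ne_top_of_le_ne_top ENNReal.one_ne_top ?_)
    calc _ ≤ ∫⁻ _, 1 ∂κ y := lintegral_mono fun x => by
            exact ENNReal.coe_le_one_iff.2 ((le_add_of_nonneg_right zero_le).trans_eq (hpq (y, x)))
      _ = 1 := by simp
  have hq' : ∀ y, (q' y : ℝ≥0∞) = ∫⁻ x, q (y, x) ∂κ y := fun y => by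
    refine ENNReal.coe_toNNReal (ne_top_of_le_ne_top ENNReal.one_ne_top ?_)
    calc _ ≤ ∫⁻ _, 1 ∂κ y := lintegral_mono fun x => by
            exact ENNReal.coe_le_one_iff.2 ((le_add_of_nonneg_left zero_le).trans_eq (hpq (y, x)))
      _ = 1 := by simp
  have hfst : π.fst = m.fst.withDensity fun y => (p' y : ℝ≥0∞) := by
    rw [hπ, ← hdis, fst_withDensity_compProd _ _ hpm, hdis]
    simp only [hp']
  have hfst' : π'.fst = m.fst.withDensity fun y => (q' y : ℝ≥0∞) := by
    rw [hπ', ← hdis, fst_withDensity_compProd _ _ hqm, hdis]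
    simp only [hq']
  have hpers := measurable_persp hn.measurable s hpm hqm
  have hD : divg ψ s π π' = ∫⁻ y, ∫⁻ x, persp ψ s (p (y, x)) (q (y, x)) ∂κ y ∂m.fst := by
    have : IsFiniteMeasure (m.withDensity fun z => (q z : ℝ≥0∞)) := by rw [← hπ']; infer_instance
    conv_lhs => rw [hπ, hπ']
    rw [divg_withDensity hn.measurable s hpm hqm]
    conv_lhs => rw [← hdis]
    rw [Measure.lintegral_compProd hpers]
  have hD' : divg ψ s π.fst π'.fst = ∫⁻ y, persp ψ s (p' y) (q' y) ∂m.fst := by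
    have : IsFiniteMeasure (m.fst.withDensity fun z => (q' z : ℝ≥0∞)) := by
      rw [← hfst']; infer_instance
    rw [hfst, hfst', divg_withDensity hn.measurable s hp'm hq'm]
  rw [hD] at hfin
  have hinner : Measurable fun y => ∫⁻ x, persp ψ s (p (y, x)) (q (y, x)) ∂κ y :=
    Measurable.lintegral_kernel_prod_right' hpers
  have hJ : ∀ᵐ y ∂m.fst, (∀ᵐ x ∂κ y, p (y, x) = p' y ∧ q (y, x) = q' y) ∨
      persp ψ s (p' y) (q' y) < ∫⁻ x, persp ψ s (p (y, x)) (q (y, x)) ∂κ y := by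
    filter_upwards [ae_lt_top hinner hfin] with y hy
    exact hn.jensen hc hp (hpm.comp measurable_prodMk_left) (hqm.comp measurable_prodMk_left)
      (fun x => hpq (y, x)) (hp' y) (hq' y) hy.ne
  have hle : ∀ᵐ y ∂m.fst, persp ψ s (p' y) (q' y) ≤
      ∫⁻ x, persp ψ s (p (y, x)) (q (y, x)) ∂κ y := by
    filter_upwards [hJ] with y hy
    rcases hy with hy | hy
    · rw [lintegral_congr_ae (g := fun _ => persp ψ s (p' y) (q' y)) (by
        filter_upwards [hy] with x hx
        rw [hx.1, hx.2])]
      simp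
    · exact hy.le
  rw [hD, hD']
  refine ⟨lintegral_mono_ae hle, fun _ hge => ⟨κ, inferInstance, ?_⟩⟩
  have heq := ae_eq_of_ae_le_of_lintegral_le hle (ne_top_of_le_ne_top hfin (lintegral_mono_ae hle))
    hinner.aemeasurable hge
  have hconst : ∀ᵐ z ∂m, p z = p' z.1 ∧ q z = q' z.1 := by
    have hset : MeasurableSet {z : Y × X | p z = p' z.1 ∧ q z = q' z.1} :=
      (measurableSet_eq_fun hpm (hp'm.comp measurable_fst)).inter
        (measurableSet_eq_fun hqm (hq'm.comp measurable_fst))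
    rw [← hdis, Measure.ae_compProd_iff hset]
    filter_upwards [hJ, heq] with y hy hy2
    exact hy.resolve_right (fun h => h.ne hy2)
  constructor
  · rw [hfst, ← compProd_withDensity_fst _ _ hp'm, hdis]
    nth_rw 1 [hπ]
    exact withDensity_congr_ae (by filter_upwards [hconst] with z hz; rw [hz.1])
  · rw [hfst', ← compProd_withDensity_fst _ _ hq'm, hdis]
    nth_rw 1 [hπ']
    exact withDensity_congr_ae (by filter_upwards [hconst] with z hz; rw [hz.2])

end Projection

/-! ### Responses and integrands normalized by a supporting line -/

section Densities

variable {X Y Z : Type u} [MeasurableSpace X] [MeasurableSpace Y] [MeasurableSpace Z]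

theorem map_withDensity_comp (n : Measure Z) {f : Z → Y} (hf : Measurable f) {w : Y → ℝ≥0∞}
    (hw : Measurable w) : (n.withDensity fun z => w (f z)).map f = (n.map f).withDensity w := by
  ext t ht
  rw [Measure.map_apply hf ht, withDensity_apply _ (hf ht), withDensity_apply _ ht,
    setLIntegral_map ht hw hf]

theorem exists_density_le {Q M : Measure Z} {u : Z → ℝ≥0} (hu : Measurable u)
    [IsFiniteMeasure (M.withDensity fun z => (u z : ℝ≥0∞))]
    (hle : Q ≤ M.withDensity fun z => (u z : ℝ≥0∞)) : ∃ q : Z → ℝ≥0, Measurable q ∧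
      (∀ z, q z ≤ u z) ∧ Q = M.withDensity (fun z => (q z : ℝ≥0∞)) := by
  obtain ⟨q, hqm, hq1, hQ⟩ := exists_density_le_one hle
  refine ⟨fun z => u z * q z, by fun_prop, fun z => mul_le_of_le_one_right zero_le (hq1 z), ?_⟩
  rw [hQ, ← withDensity_mul _ (by fun_prop) (by fun_prop)]
  congr 1

theorem restrict_withDensity_coe (M : Measure Z) {u : Z → ℝ≥0} {S : Set Z} (hS : MeasurableSet S) :
    (M.withDensity fun z => (u z : ℝ≥0∞)).restrict S =
      M.withDensity fun z => ((S.indicator u z : ℝ≥0) : ℝ≥0∞) := by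
  rw [restrict_withDensity hS, ← withDensity_indicator hS]
  congr 1
  ext z
  by_cases hz : z ∈ S <;> simp [hz]

theorem withDensity_coe_apply_univ (M : Measure Z) (u : Z → ℝ≥0∞) :
    M.withDensity u Set.univ = ∫⁻ z, u z ∂M := by
  rw [withDensity_apply _ MeasurableSet.univ, Measure.restrict_univ]

theorem withDensity_le_self (M : Measure Z) {u : Z → ℝ≥0∞} (hu : ∀ z, u z ≤ 1) :
    M.withDensity u ≤ M := by
  conv_rhs => rw [← withDensity_one (μ := M)]
  exact withDensity_mono (ae_of_all _ hu)

/-- For every plan `ρ` and every plan `ρ₀` of the other side, there is a plan `ρ'` of the other side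
whose divergence from `ρ` is that of the marginals: rescale `ρ` where its marginal has mass, and
follow `ρ₀` elsewhere. -/
theorem exists_response {f : Z → Y} (hf : Measurable f) (ρ ρ₀ : Measure Z) [IsFiniteMeasure ρ]
    [IsFiniteMeasure ρ₀] : ∃ ρ' : Measure Z, IsFiniteMeasure ρ' ∧ ρ' ≪ ρ + ρ₀ ∧
      ρ'.map f = ρ₀.map f ∧ ∀ (ψ : ℝ≥0 → ℝ≥0∞) (s : ℝ≥0∞), Measurable ψ →
        divg ψ s ρ ρ' = divg ψ s (ρ.map f) (ρ₀.map f) := by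
  obtain ⟨p, q, hpm, hqm, -, hP, hQ⟩ := exists_density_pair (ρ.map f) (ρ₀.map f)
  set M := ρ.map f + ρ₀.map f
  set N : Set Y := {y | p y = 0} with hNdef
  have hN : MeasurableSet N := hpm (measurableSet_singleton 0)
  have hPN : (ρ.map f) N = 0 := by
    rw [hP, withDensity_apply _ hN, setLIntegral_eq_zero_iff hN (by fun_prop)]
    exact ae_of_all _ fun y hy => by simpa [hNdef] using hy
  have hPae : ∀ᵐ y ∂(ρ.map f), y ∉ N := measure_eq_zero_iff_ae_notMem.1 hPN
  set n := ρ + ρ₀.restrict (f ⁻¹' N) with hn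
  set u : Y → ℝ≥0 := fun y => if p y = 0 then 0 else 1
  set w : Y → ℝ≥0 := fun y => if p y = 0 then 1 else q y / p y
  have hum : Measurable u := Measurable.ite hN measurable_const measurable_const
  have hwm : Measurable w := Measurable.ite hN measurable_const (by fun_prop)
  have hρ : ρ = n.withDensity fun z => ((u (f z) : ℝ≥0) : ℝ≥0∞) := by
    have e1 : ρ.withDensity (fun z => ((u (f z) : ℝ≥0) : ℝ≥0∞)) = ρ := by
      conv_rhs => rw [← withDensity_one (μ := ρ)]
      refine withDensity_congr_ae ?_
      filter_upwards [ae_of_ae_map hf.aemeasurable hPae] with z hz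
      have hz' : p (f z) ≠ 0 := hz
      simp [u, hz']
    have e2 : (ρ₀.restrict (f ⁻¹' N)).withDensity (fun z => ((u (f z) : ℝ≥0) : ℝ≥0∞)) = 0 := by
      rw [withDensity_eq_zero_iff (by fun_prop)]
      filter_upwards [ae_restrict_mem (hf hN)] with z hz
      have hz' : p (f z) = 0 := hz
      simp [u, hz']
    rw [hn, withDensity_add_measure, e1, e2, add_zero]
  have hmap : n.map f = ρ.map f + (ρ₀.map f).restrict N := by
    rw [hn, Measure.map_add _ _ hf, Measure.restrict_map hf hN]
  have hw : (n.map f).withDensity (fun y => (w y : ℝ≥0∞)) = ρ₀.map f := by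
    have e1 : (ρ.map f).withDensity (fun y => (w y : ℝ≥0∞)) = (ρ₀.map f).restrict Nᶜ := by
      conv_rhs => rw [hQ, restrict_withDensity_coe _ hN.compl]
      conv_lhs => rw [hP]
      rw [← withDensity_mul _ (by fun_prop) (by fun_prop)]
      congr 1
      ext y
      by_cases hy : p y = 0
      · simp [hy, hNdef]
      · simp only [Pi.mul_apply, w, if_neg hy, hNdef]
        rw [Set.indicator_of_mem (by simpa using hy), ← ENNReal.coe_mul, mul_div_cancel₀ _ hy]
    have e2 : ((ρ₀.map f).restrict N).withDensity (fun y => (w y : ℝ≥0∞)) =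
        (ρ₀.map f).restrict N := by
      conv_rhs => rw [← withDensity_one (μ := (ρ₀.map f).restrict N)]
      refine withDensity_congr_ae ?_
      filter_upwards [ae_restrict_mem hN] with y hy
      have hy' : p y = 0 := hy
      simp [w, hy']
    rw [hmap, withDensity_add_measure, e1, e2, add_comm, Measure.restrict_add_restrict_compl hN]
  have hu : (n.map f).withDensity (fun y => (u y : ℝ≥0∞)) = ρ.map f := by
    rw [← map_withDensity_comp n hf (by fun_prop), ← hρ]
  have hρ' : (n.withDensity fun z => ((w (f z) : ℝ≥0) : ℝ≥0∞)).map f = ρ₀.map f := by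
    rw [map_withDensity_comp n hf (w := fun y => (w y : ℝ≥0∞)) (by fun_prop), hw]
  have hfin : IsFiniteMeasure (n.withDensity fun z => ((w (f z) : ℝ≥0) : ℝ≥0∞)) := by
    constructor
    have := congrArg (fun μ => μ Set.univ) hρ'
    simp only [Measure.map_apply hf MeasurableSet.univ, Set.preimage_univ] at this
    rw [this]
    exact measure_lt_top _ _
  refine ⟨_, hfin, ?_, hρ', fun ψ s hψ => ?_⟩
  · refine (withDensity_absolutelyContinuous _ _).trans ?_
    exact Measure.AbsolutelyContinuous.add Measure.AbsolutelyContinuous.rfl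
      Measure.restrict_le_self.absolutelyContinuous
  · have : IsFiniteMeasure ((n.map f).withDensity fun y => (w y : ℝ≥0∞)) := by
      rw [hw]; infer_instance
    conv_lhs => rw [hρ]
    rw [divg_withDensity hψ s (p := fun z => u (f z)) (q := fun z => w (f z)) (hum.comp hf)
      (hwm.comp hf), ← hu, ← hw, divg_withDensity hψ s hum hwm,
      lintegral_map (measurable_persp hψ s hum hwm) hf]

end Densities

section Support

variable {θ : ℝ≥0 → EReal} {A B : ℝ} {ψ : ℝ≥0 → ℝ≥0∞} {s : ℝ≥0∞}

theorem IsNormalization.eq_zero (hn : IsNormalization θ A B ψ s) {c : ℝ≥0}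
    (hcc : θ c = ((A * c + B : ℝ) : EReal)) : ψ c = 0 := by
  have hct : θ c ≠ ⊤ := by rw [hcc]; exact EReal.coe_ne_top _
  have h := hn.toReal hct
  rw [hcc, EReal.toReal_coe] at h
  exact ((ENNReal.toReal_eq_zero_iff _).1 (by linarith)).resolve_right (hn.ne_top_iff.2 hct)

/-- Normalized by a supporting line at `c`, the integrand decreases strictly up to `c`. -/
theorem IsNormalization.lt_left_of_support (hn : IsNormalization θ A B ψ s)
    (hc : IsStrictlyConvexOnDom θ) (hp : IsProper θ) {c : ℝ≥0}
    (hcc : θ c = ((A * c + B : ℝ) : EReal))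
    (h : ∀ x, x ≠ c → ((A * x + B : ℝ) : EReal) < θ x) {x y : ℝ≥0} (hxy : x < y) (hyc : y ≤ c)
    (hx : ψ x ≠ ⊤) : ψ y < ψ x := by
  have hθx := hn.ne_top_iff.1 hx
  have hct : θ c ≠ ⊤ := by rw [hcc]; exact EReal.coe_ne_top _
  have hx0 : 0 < (ψ x).toReal := by
    have h1 := h x (hxy.trans_le hyc).ne
    rw [← hp.coe_toReal hθx, EReal.coe_lt_coe_iff, hn.toReal hθx] at h1
    linarith
  rcases hyc.eq_or_lt with rfl | hyc
  · rw [hn.eq_zero hcc]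
    exact ENNReal.toReal_pos_iff.1 hx0 |>.1
  · obtain ⟨hyt, h3⟩ := hc.three_point hp hxy hyc hθx hct
    rw [hn.toReal hyt, hn.toReal hθx, hn.toReal hct, hn.eq_zero hcc, ENNReal.toReal_zero] at h3
    have hxy' : (x : ℝ) < y := hxy
    have hyc' : (y : ℝ) < c := hyc
    rw [← ENNReal.toReal_lt_toReal (hn.ne_top_iff.2 hyt) hx]
    have h4 : ((c : ℝ) - x) * (ψ y).toReal < (c - y) * (ψ x).toReal := by
      linear_combination h3
    have h5 : ((c : ℝ) - y) * (ψ x).toReal ≤ (c - x) * (ψ x).toReal :=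
      mul_le_mul_of_nonneg_right (by linarith) hx0.le
    exact lt_of_mul_lt_mul_left (h4.trans_le h5) (by linarith)

/-- Normalized by a supporting line at `c`, the integrand increases from `c` on. -/
theorem IsNormalization.le_right_of_support (hn : IsNormalization θ A B ψ s)
    (hc : IsStrictlyConvexOnDom θ) (hp : IsProper θ) {c : ℝ≥0}
    (hcc : θ c = ((A * c + B : ℝ) : EReal)) {x y : ℝ≥0} (hcy : c ≤ y) (hyx : y ≤ x) :
    ψ y ≤ ψ x := by
  by_cases hx : ψ x = ⊤
  · rw [hx]; exact le_top
  have hθx := hn.ne_top_iff.1 hx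
  have hct : θ c ≠ ⊤ := by rw [hcc]; exact EReal.coe_ne_top _
  rcases hcy.eq_or_lt with rfl | hcy
  · rw [hn.eq_zero hcc]; exact zero_le
  rcases hyx.eq_or_lt with rfl | hyx
  · exact le_rfl
  obtain ⟨hyt, h3⟩ := hc.three_point hp hcy hyx hct hθx
  rw [hn.toReal hyt, hn.toReal hθx, hn.toReal hct, hn.eq_zero hcc, ENNReal.toReal_zero] at h3
  have hxy' : (y : ℝ) < x := hyx
  have hyc' : (c : ℝ) < y := hcy
  rw [← ENNReal.toReal_le_toReal (hn.ne_top_iff.2 hyt) hx]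
  have h4 : ((x : ℝ) - c) * (ψ y).toReal < (y - c) * (ψ x).toReal := by
    linear_combination h3
  have h5 : ((y : ℝ) - c) * (ψ x).toReal ≤ (x - c) * (ψ x).toReal :=
    mul_le_mul_of_nonneg_right (by linarith) ENNReal.toReal_nonneg
  exact (lt_of_mul_lt_mul_left (h4.trans_le h5) (by linarith)).le

end Support

/-! ### The exchange argument -/

section Exchange

variable {X Y Z : Type u} [MeasurableSpace X] [MeasurableSpace Y] [MeasurableSpace Z]

theorem IsNormalization.divg_ne_top {θ : ℝ≥0 → EReal} {A B : ℝ} {ψ : ℝ≥0 → ℝ≥0∞} {s : ℝ≥0∞}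
    (hn : IsNormalization θ A B ψ s) {P Q : Measure X} [IsFiniteMeasure P] [IsFiniteMeasure Q]
    (h : thetaDiv θ X P Q < ⊤) : divg ψ s P Q ≠ ⊤ := by
  intro h1
  rw [hn.thetaDiv_eq, h1] at h
  exact h.ne rfl

/-- For fixed total masses, comparing divergences means comparing their nonnegative parts. -/
theorem IsNormalization.thetaDiv_le_iff {θ : ℝ≥0 → EReal} {A B : ℝ} {ψ : ℝ≥0 → ℝ≥0∞}
    {s : ℝ≥0∞} (hn : IsNormalization θ A B ψ s) {P Q : Measure X} {P' Q' : Measure Y}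
    [IsFiniteMeasure P] [IsFiniteMeasure Q] [IsFiniteMeasure P'] [IsFiniteMeasure Q']
    (hP : P Set.univ = P' Set.univ) (hQ : Q Set.univ = Q' Set.univ) :
    thetaDiv θ X P Q ≤ thetaDiv θ Y P' Q' ↔ divg ψ s P Q ≤ divg ψ s P' Q' := by
  rw [hn.thetaDiv_eq, hn.thetaDiv_eq, measureReal_def, measureReal_def, measureReal_def,
    measureReal_def, hP, hQ, (EReal.addLECancellable_coe _).add_le_add_iff_right,
    EReal.coe_ennreal_le_coe_ennreal_iff]

/-- Moving mass `ε a` to points of density ratio below `r` and mass `ε b` away from points of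
density ratio at least `t` decreases the integrand normalized at the midpoint `c` of `r` and `t`. -/
theorem IsNormalization.persp_exchange {θ : ℝ≥0 → EReal} {A B : ℝ} {ψ : ℝ≥0 → ℝ≥0∞} {s : ℝ≥0∞}
    (hn : IsNormalization θ A B ψ s) (hc : IsStrictlyConvexOnDom θ) (hp : IsProper θ)
    {r t c ε : ℝ≥0} (hcc : θ c = ((A * c + B : ℝ) : EReal))
    (h : ∀ x, x ≠ c → ((A * x + B : ℝ) : EReal) < θ x) (hrt : r < t) (hlow : r + ε * t = c)
    (hhigh : c + ε * t = t) (hε : 0 < ε) {p q a b : ℝ≥0} (ha : a ≤ if p < r * q then t * q else 0)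
    (hb : b ≤ if t * q ≤ p then p else 0) :
    persp ψ s (p + ε * a - ε * b) q ≤ persp ψ s p q ∧
      (a ≠ 0 → persp ψ s p q ≠ ⊤ → persp ψ s (p + ε * a - ε * b) q < persp ψ s p q) := by
  have hdisj : p < r * q → ¬ t * q ≤ p := fun h1 h2 =>
    absurd (h1.trans_le (mul_le_mul_left hrt.le q)) (not_lt.2 h2)
  by_cases hL : p < r * q
  · have hb0 : b = 0 := by simpa [hdisj hL] using hb
    rw [if_pos hL] at ha
    have hq0 : q ≠ 0 := by rintro rfl; simp at hL
    have hqpos : 0 < q := pos_iff_ne_zero.2 hq0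
    have hle : (p + ε * a) / q ≤ c := by
      rw [div_le_iff₀ hqpos, ← hlow, add_mul, mul_assoc]
      exact add_le_add hL.le (mul_le_mul_right ha _)
    simp only [hb0, mul_zero, tsub_zero, persp, if_neg hq0]
    have hstrict : a ≠ 0 → ψ (p / q) ≠ ⊤ → ψ ((p + ε * a) / q) < ψ (p / q) := fun ha0 hfin =>
      hn.lt_left_of_support hc hp hcc h (div_lt_div_of_pos_right
        (lt_add_of_pos_right _ (mul_pos hε (pos_iff_ne_zero.2 ha0))) hqpos) hle hfin
    constructor
    · by_cases ha0 : a = 0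
      · simp [ha0]
      by_cases hfin : ψ (p / q) = ⊤
      · rw [hfin, ENNReal.mul_top (by simpa using hq0)]; exact le_top
      · exact mul_le_mul_right (hstrict ha0 hfin).le _
    · intro ha0 hfin
      have hfin' : ψ (p / q) ≠ ⊤ := fun h0 =>
        hfin (by rw [h0, ENNReal.mul_top (by simpa using hq0)])
      exact (ENNReal.mul_lt_mul_iff_right (by simpa using hq0) ENNReal.coe_ne_top).2
        (hstrict ha0 hfin')
  · have ha0 : a = 0 := by simpa [hL] using ha
    refine ⟨?_, fun h0 => (h0 ha0).elim⟩
    rw [ha0, mul_zero, add_zero]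
    by_cases hH : t * q ≤ p
    · rw [if_pos hH] at hb
      by_cases hq0 : q = 0
      · simp only [persp, hq0, if_true]
        exact mul_le_mul_left (by exact_mod_cast tsub_le_self) _
      · have hqpos : 0 < q := pos_iff_ne_zero.2 hq0
        simp only [persp, if_neg hq0]
        refine mul_le_mul_right (hn.le_right_of_support hc hp hcc ?_ ?_) _
        · rw [le_div_iff₀ hqpos]
          have hε1 : ε ≤ 1 := by
            have ht : 0 < t := pos_of_gt hrt
            have : ε * t ≤ 1 * t := by
              rw [one_mul]; exact (le_add_left le_rfl).trans_eq hhigh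
            exact le_of_mul_le_mul_right this ht
          refine le_tsub_of_add_le_right ?_
          -- `c q + ε b ≤ c q + ε p = (1 - ε) t q + ε p ≤ (1 - ε) p + ε p`
          rw [← NNReal.coe_le_coe]
          have e1 : (c : ℝ) + ε * t = t := by exact_mod_cast hhigh
          have e2 : (t : ℝ) * q ≤ p := by exact_mod_cast hH
          have e3 : (b : ℝ) ≤ p := by exact_mod_cast hb
          have e4 : (ε : ℝ) ≤ 1 := by exact_mod_cast hε1
          have e5 : (c : ℝ) * q = (1 - ε) * (t * q) := by linear_combination (q : ℝ) * e1
          push_cast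
          nlinarith [mul_le_mul_of_nonneg_left e2 (sub_nonneg.2 e4),
            mul_le_mul_of_nonneg_left e3 ε.coe_nonneg]
        · exact div_le_div_of_nonneg_right tsub_le_self zero_le
    · have hb0 : b = 0 := by simpa [hH] using hb
      simp [hb0]

/-- Measures minimizing the divergence from a fixed measure within a class of payloads admit no
profitable exchange: a subplan `σ` cannot bring more mass to the region of payload density below
`r` than the plan `π` brings to the region of density below `t`, for `r < t`. -/
theorem exchange {θ : ℝ≥0 → EReal} (hl : LowerSemicontinuous θ) (hc : IsStrictlyConvexOnDom θ)
    (hp : IsProper θ) {f : Z → Y} {g : Z → X} (hf : Measurable f) (hg : Measurable g)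
    {π σ : Measure Z} [IsFiniteMeasure π] [IsFiniteMeasure σ] {lam M : Measure Y}
    [IsFiniteMeasure lam] {p q : Y → ℝ≥0} (hpm : Measurable p) (hqm : Measurable q)
    (hP : π.map f = M.withDensity fun y => (p y : ℝ≥0∞))
    (hQ : lam = M.withDensity fun y => (q y : ℝ≥0∞))
    (hfin : thetaDiv θ Y (π.map f) lam < ⊤)
    (hmin : ∀ ρ : Measure Z, IsFiniteMeasure ρ → ρ ≪ π + σ → ρ.map g = π.map g →
      thetaDiv θ Y (π.map f) lam ≤ thetaDiv θ Y (ρ.map f) lam)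
    {r t : ℝ≥0} (hrt : r < t) (hσg : σ.map g ≤ π.map g) (hσf : σ.map f ≤ t • lam) :
    σ (f ⁻¹' {y | p y < r * q y}) ≤ (π.map f) {y | p y < t * q y} := by
  set L : Set Y := {y | p y < r * q y}
  set H : Set Y := {y | t * q y ≤ p y}
  have hL : MeasurableSet L := measurableSet_lt hpm (by fun_prop)
  have hH : MeasurableSet H := measurableSet_le (by fun_prop) hpm
  -- `G` is the fraction of each vertex that `σ` sends to `L`, and `h` the one that `π` sends
  -- to `H`.
  obtain ⟨G, hGm, hG1, hG⟩ := exists_density_le_one (M := π.map g)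
    (Q := (σ.restrict (f ⁻¹' L)).map g)
    ((Measure.map_mono Measure.restrict_le_self hg).trans hσg)
  obtain ⟨h, hhm, hh1, hh⟩ := exists_density_le_one (M := π.map g)
    (Q := (π.restrict (f ⁻¹' H)).map g) (Measure.map_mono Measure.restrict_le_self hg)
  suffices hGh : ∫⁻ x, (G x * h x : ℝ≥0) ∂(π.map g) = 0 by
    have hae : ∀ᵐ x ∂(π.map g), G x * h x = 0 := by
      filter_upwards [(lintegral_eq_zero_iff (by fun_prop)).1 hGh] with x hx
      simpa using hx
    set S : Set X := {x | h x = 0}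
    have hS : MeasurableSet S := hhm (measurableSet_singleton 0)
    have hHS : π (f ⁻¹' H ∩ g ⁻¹' S) = 0 := by
      have h1 := congrArg (fun μ => μ S) hh
      rw [Measure.map_apply hg hS, Measure.restrict_apply (hg hS), Set.inter_comm,
        withDensity_apply _ hS] at h1
      rw [h1, setLIntegral_eq_zero_iff hS (by fun_prop)]
      exact ae_of_all _ fun x hx => by simpa [S] using hx
    calc σ (f ⁻¹' L) = (σ.restrict (f ⁻¹' L)).map g Set.univ := by
          rw [Measure.map_apply hg MeasurableSet.univ]; simp
      _ = ∫⁻ x, G x ∂(π.map g) := by rw [hG, withDensity_coe_apply_univ]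
      _ ≤ ∫⁻ x, S.indicator 1 x ∂(π.map g) := by
          refine lintegral_mono_ae ?_
          filter_upwards [hae] with x hx
          by_cases hxS : x ∈ S
          · simpa [hxS] using hG1 x
          · have : G x = 0 := (mul_eq_zero.1 hx).resolve_right hxS
            simp [this]
      _ = π (g ⁻¹' S) := by rw [lintegral_indicator_one hS, Measure.map_apply hg hS]
      _ ≤ π (f ⁻¹' H ∩ g ⁻¹' S) + π (f ⁻¹' {y | p y < t * q y}) := by
          refine (measure_mono fun z hz => ?_).trans (measure_union_le _ _)
          by_cases hzH : f z ∈ H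
          · exact .inl ⟨hzH, hz⟩
          · exact .inr (not_le.1 (show ¬ t * q (f z) ≤ p (f z) from hzH))
      _ = (π.map f) {y | p y < t * q y} := by
          rw [hHS, zero_add, Measure.map_apply hf (measurableSet_lt hpm (by fun_prop))]
  by_contra hGh
  have ht0 : 0 < t := pos_of_gt hrt
  -- At rate `ε`, ratios below `r` rise to at most `c`, and ratios above `t` drop to at least `c`.
  obtain ⟨c, ε, hlow, hhigh, hε⟩ : ∃ c ε : ℝ≥0, r + ε * t = c ∧ c + ε * t = t ∧ 0 < ε := by
    refine ⟨(r + t) / 2, (t - r) / (2 * t), ?_, ?_, div_pos (tsub_pos_of_lt hrt) (by positivity)⟩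
    all_goals
      rw [← NNReal.coe_inj]
      push_cast [NNReal.coe_sub hrt.le]
      have : (t : ℝ) ≠ 0 := by positivity
      field_simp
      ring
  have hrc : r < c := by rw [← hlow]; exact lt_add_of_pos_right _ (mul_pos hε ht0)
  have hct : c < t := by
    conv_rhs => rw [← hhigh]
    exact lt_add_of_pos_right _ (mul_pos hε ht0)
  have hε1 : ε ≤ 1 := by
    have : ε * t ≤ 1 * t := by rw [one_mul]; exact (le_add_left le_rfl).trans_eq hhigh
    exact le_of_mul_le_mul_right this ht0
  -- The mass to be moved in and out, at unit rate.
  set inn : Measure Z := (σ.restrict (f ⁻¹' L)).withDensity fun z => ((h (g z) : ℝ≥0) : ℝ≥0∞)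
  set out : Measure Z := (π.restrict (f ⁻¹' H)).withDensity fun z => ((G (g z) : ℝ≥0) : ℝ≥0∞)
  have hinn_le : inn ≤ σ.restrict (f ⁻¹' L) :=
    withDensity_le_self _ fun z => by exact_mod_cast hh1 (g z)
  have hout_le : out ≤ π.restrict (f ⁻¹' H) :=
    withDensity_le_self _ fun z => by exact_mod_cast hG1 (g z)
  have : IsFiniteMeasure inn := isFiniteMeasure_of_le _ hinn_le
  have : IsFiniteMeasure out := isFiniteMeasure_of_le _ hout_le
  have hinn_g : inn.map g = (π.map g).withDensity fun x => ((G x * h x : ℝ≥0) : ℝ≥0∞) := by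
    rw [map_withDensity_comp _ hg (w := fun x => (h x : ℝ≥0∞)) (by fun_prop), hG,
      ← withDensity_mul _ (by fun_prop) (by fun_prop)]
    congr 1
  have hout_g : out.map g = (π.map g).withDensity fun x => ((G x * h x : ℝ≥0) : ℝ≥0∞) := by
    rw [map_withDensity_comp _ hg (w := fun x => (G x : ℝ≥0∞)) (by fun_prop), hh,
      ← withDensity_mul _ (by fun_prop) (by fun_prop)]
    congr 1
    ext x
    simp [mul_comm]
  set k : Z → ℝ≥0 := fun z => (f ⁻¹' H).indicator (fun z => G (g z)) z
  have hkm : Measurable k := Measurable.indicator (by fun_prop) (hf hH)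
  have hk1 : ∀ z, k z ≤ 1 := fun z => by
    by_cases hz : z ∈ f ⁻¹' H
    · simpa [k, hz] using hG1 (g z)
    · simp [k, hz]
  have hout : out = π.withDensity fun z => (k z : ℝ≥0∞) := by
    simp only [out]
    rw [← withDensity_indicator (hf hH)]
    congr 1
    ext z
    by_cases hz : z ∈ f ⁻¹' H <;> simp [k, hz]
  obtain ⟨ρ, hbal⟩ : ∃ ρ, ρ + ε • out = π + ε • inn := by
    refine ⟨π.withDensity (fun z => ((1 - ε * k z : ℝ≥0) : ℝ≥0∞)) + ε • inn, ?_⟩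
    have e1 : ε • out = π.withDensity fun z => ((ε * k z : ℝ≥0) : ℝ≥0∞) := by
      rw [hout, ENNReal.smul_def, ← withDensity_smul _ (by fun_prop)]
      congr 1
    rw [add_right_comm, e1, ← withDensity_add_left (by fun_prop)]
    congr 1
    conv_rhs => rw [← withDensity_one (μ := π)]
    congr 1
    ext z
    simp only [Pi.add_apply, Pi.one_apply, ← ENNReal.coe_add]
    rw [tsub_add_cancel_of_le (mul_le_one' hε1 (hk1 z)), ENNReal.coe_one]
  have hρle : ρ ≤ π + ε • inn := by rw [← hbal]; exact Measure.le_add_right le_rfl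
  have : IsFiniteMeasure ρ := isFiniteMeasure_of_le _ hρle
  have hρac : ρ ≪ π + σ := by
    refine hρle.absolutelyContinuous.trans
      (Measure.AbsolutelyContinuous.add Measure.AbsolutelyContinuous.rfl ?_)
    exact (Measure.smul_absolutelyContinuous).trans
      (hinn_le.trans Measure.restrict_le_self).absolutelyContinuous
  have hρg : ρ.map g = π.map g := by
    have h1 := congrArg (Measure.map g) hbal
    rw [Measure.map_add _ _ hg, Measure.map_add _ _ hg, Measure.map_smul, Measure.map_smul, hinn_g,
      ← hout_g] at h1
    exact measure_add_right_cancel h1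
  -- Densities of the moved payload.
  have hfinQ : IsFiniteMeasure (M.withDensity fun y => (q y : ℝ≥0∞)) := by
    rw [← hQ]; infer_instance
  have hfinP : IsFiniteMeasure (M.withDensity fun y => (p y : ℝ≥0∞)) := by
    rw [← hP]; infer_instance
  have htq : t • lam = M.withDensity fun y => ((t * q y : ℝ≥0) : ℝ≥0∞) := by
    rw [hQ, ENNReal.smul_def, ← withDensity_smul _ (by fun_prop)]
    congr 1
  have hLq : (M.withDensity fun y => ((t * q y : ℝ≥0) : ℝ≥0∞)).restrict L =
      M.withDensity fun y => ((L.indicator (fun y => t * q y) y : ℝ≥0) : ℝ≥0∞) :=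
    restrict_withDensity_coe _ hL
  have hHp : (M.withDensity fun y => ((p y : ℝ≥0) : ℝ≥0∞)).restrict H =
      M.withDensity fun y => ((H.indicator p y : ℝ≥0) : ℝ≥0∞) := restrict_withDensity_coe _ hH
  have hfin1 : IsFiniteMeasure
      (M.withDensity fun y => ((L.indicator (fun y => t * q y) y : ℝ≥0) : ℝ≥0∞)) := by
    rw [← hLq, ← htq]; infer_instance
  have hfin2 : IsFiniteMeasure (M.withDensity fun y => ((H.indicator p y : ℝ≥0) : ℝ≥0∞)) := by
    rw [← hHp]; infer_instance
  obtain ⟨a, ham, hale, ha⟩ := exists_density_le (M := M) (Q := inn.map f)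
    (u := fun y => L.indicator (fun y => t * q y) y) (Measurable.indicator (by fun_prop) hL) (by
      rw [← hLq, ← htq]
      calc inn.map f ≤ (σ.restrict (f ⁻¹' L)).map f := Measure.map_mono hinn_le hf
        _ = (σ.map f).restrict L := (Measure.restrict_map hf hL).symm
        _ ≤ (t • lam).restrict L := Measure.restrict_mono le_rfl hσf)
  obtain ⟨b, hbm, hble, hb⟩ := exists_density_le (M := M) (Q := out.map f)
    (u := fun y => H.indicator p y) (Measurable.indicator hpm hH) (by
      rw [← hHp, ← hP]
      calc out.map f ≤ (π.restrict (f ⁻¹' H)).map f := Measure.map_mono hout_le hf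
        _ = (π.map f).restrict H := (Measure.restrict_map hf hH).symm)
  have hale' : ∀ y, a y ≤ if p y < r * q y then t * q y else 0 := fun y => by
    simpa [Set.indicator, L] using hale y
  have hble' : ∀ y, b y ≤ if t * q y ≤ p y then p y else 0 := fun y => by
    refine (hble y).trans_eq ?_
    by_cases hy : t * q y ≤ p y <;> simp [Set.indicator, H, hy]
  have hbp : ∀ y, ε * b y ≤ p y + ε * a y := fun y =>
    calc ε * b y ≤ 1 * b y := mul_le_mul_left hε1 _
      _ ≤ p y := by
          rw [one_mul]
          refine (hble' y).trans ?_
          split_ifs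
          exacts [le_rfl, zero_le]
      _ ≤ p y + ε * a y := le_add_right le_rfl
  have hρf : ρ.map f = M.withDensity fun y => ((p y + ε * a y - ε * b y : ℝ≥0) : ℝ≥0∞) := by
    have h1 := congrArg (Measure.map f) hbal
    rw [Measure.map_add _ _ hf, Measure.map_add _ _ hf, Measure.map_smul, Measure.map_smul, ha, hP]
      at h1
    refine measure_add_right_cancel (c := ε • out.map f) ?_
    rw [h1, hb, ENNReal.smul_def, ENNReal.smul_def, ← withDensity_smul _ (by fun_prop),
      ← withDensity_smul _ (by fun_prop), ← withDensity_add_left (by fun_prop),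
      ← withDensity_add_left (by fun_prop)]
    congr 1
    ext y
    simp only [Pi.add_apply, Pi.smul_apply, smul_eq_mul, ← ENNReal.coe_mul, ← ENNReal.coe_add]
    rw [tsub_add_cancel_of_le (hbp y)]
  have haint : ∫⁻ y, a y ∂M ≠ 0 := by
    have h1 : inn.map f Set.univ = inn.map g Set.univ := by
      rw [Measure.map_apply hf MeasurableSet.univ, Measure.map_apply hg MeasurableSet.univ]
      rfl
    rwa [ha, hinn_g, withDensity_coe_apply_univ, withDensity_coe_apply_univ] at h1 ▸ hGh
  have hbint : ∫⁻ y, b y ∂M ≠ 0 := by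
    have h1 : out.map f Set.univ = out.map g Set.univ := by
      rw [Measure.map_apply hf MeasurableSet.univ, Measure.map_apply hg MeasurableSet.univ]
      rfl
    rwa [hb, hout_g, withDensity_coe_apply_univ, withDensity_coe_apply_univ] at h1 ▸ hGh
  -- Finiteness of the divergence gives points of the domain on both sides of `c`.
  obtain ⟨A₀, B₀, hmino⟩ := hc.exists_minorant hp
  obtain ⟨ψ₀, s₀, hn₀⟩ := exists_isNormalization hl.measurable hmino
  have hD₀ := hn₀.divg_ne_top hfin
  rw [hP, hQ, divg_withDensity hn₀.measurable _ hpm hqm] at hD₀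
  have hae₀ := ae_lt_top (measurable_persp hn₀.measurable s₀ hpm hqm) hD₀
  obtain ⟨y₁, hy₁, hf₁⟩ : ∃ y, a y ≠ 0 ∧ persp ψ₀ s₀ (p y) (q y) ≠ ⊤ := by
    by_contra hcon
    push Not at hcon
    refine haint ((lintegral_eq_zero_iff (by fun_prop)).2 ?_)
    filter_upwards [hae₀] with y hy
    by_contra h0
    exact hy.ne (hcon y fun h1 => h0 (by simp [h1]))
  obtain ⟨y₂, hy₂, hf₂⟩ : ∃ y, b y ≠ 0 ∧ persp ψ₀ s₀ (p y) (q y) ≠ ⊤ := by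
    by_contra hcon
    push Not at hcon
    refine hbint ((lintegral_eq_zero_iff (by fun_prop)).2 ?_)
    filter_upwards [hae₀] with y hy
    by_contra h0
    exact hy.ne (hcon y fun h1 => h0 (by simp [h1]))
  have hL₁ : p y₁ < r * q y₁ := by
    by_contra h1
    exact hy₁ (by simpa [h1] using hale' y₁)
  have hH₂ : t * q y₂ ≤ p y₂ := by
    by_contra h1
    exact hy₂ (by simpa [h1] using hble' y₂)
  have hq₁ : q y₁ ≠ 0 := by intro h1; simp [h1] at hL₁
  have hx₁ : p y₁ / q y₁ < c := ((div_lt_iff₀ (pos_iff_ne_zero.2 hq₁)).2 hL₁).trans hrc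
  have hdom₁ := hn₀.ne_top_iff.1 ((persp_ne_top_iff_of_ne hq₁).1 hf₁)
  obtain ⟨x₂, hx₂, hdom₂⟩ := hn₀.exists_dom_gt hc hp hdom₁ hx₁ (p := p y₂) (q := q y₂) (by
    by_cases hq₂ : q y₂ = 0
    · rw [hq₂, mul_zero]
      have := hble' y₂
      rw [if_pos hH₂] at this
      exact (pos_iff_ne_zero.2 hy₂).trans_le this
    · exact (mul_lt_mul_of_pos_right hct (pos_iff_ne_zero.2 hq₂)).trans_le hH₂) hf₂
  obtain ⟨A, B, hcc, hsup⟩ := hc.exists_support hp hx₁ hx₂ hdom₁ hdom₂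
  obtain ⟨ψ, s, hn⟩ := exists_isNormalization hl.measurable (A := A) (B := B) fun x => by
    by_cases hx : x = c
    · rw [hx, hcc]
    · exact (hsup x hx).le
  have huniv : (π.map f) Set.univ = (ρ.map f) Set.univ := by
    have := congrArg (fun μ => μ Set.univ) hρg
    simp only [Measure.map_apply hg MeasurableSet.univ, Set.preimage_univ] at this
    rw [Measure.map_apply hf MeasurableSet.univ, Measure.map_apply hf MeasurableSet.univ]
    exact this.symm
  have hle := (hn.thetaDiv_le_iff huniv rfl).1 (hmin ρ inferInstance hρac hρg)
  have hD := hn.divg_ne_top hfin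
  rw [hP, hQ, divg_withDensity hn.measurable _ hpm hqm] at hD
  rw [hρf, hP, hQ, divg_withDensity hn.measurable _ hpm hqm, divg_withDensity hn.measurable _
    (by fun_prop) hqm] at hle
  have hex := fun y => hn.persp_exchange hc hp hcc hsup hrt hlow hhigh hε (hale' y) (hble' y)
  have hlt : ∀ᵐ y ∂M, persp ψ s (p y) (q y) < ⊤ :=
    ae_lt_top (measurable_persp hn.measurable s hpm hqm) hD
  have heq := ae_eq_of_ae_le_of_lintegral_le (ae_of_all M fun y => (hex y).1)
    (ne_top_of_le_ne_top hD (lintegral_mono fun y => (hex y).1))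
    (measurable_persp hn.measurable s hpm hqm).aemeasurable hle
  refine haint ((lintegral_eq_zero_iff (by fun_prop)).2 ?_)
  filter_upwards [heq, hlt] with y hy hyt
  by_contra h0
  exact ((hex y).2 (fun h1 => h0 (by simp [h1])) hyt.ne).ne hy


end Exchange

/-! ### Structure of closest pairs -/

section Level

variable {X Y Z : Type u} [MeasurableSpace X] [MeasurableSpace Y] [MeasurableSpace Z]

/-- The mass of the truncated payload in terms of densities. -/
theorem truncated_mass {M : Measure Y} {p q : Y → ℝ≥0} (hpm : Measurable p) (hqm : Measurable q)
    [IsFiniteMeasure (M.withDensity fun y => (q y : ℝ≥0∞))] (t : ℝ≥0) :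
    ((M.withDensity fun y => (q y : ℝ≥0∞)).withDensity fun y =>
      min ((M.withDensity fun y => (p y : ℝ≥0∞)).rnDeriv (M.withDensity fun y => (q y : ℝ≥0∞)) y)
        (t : ℝ≥0∞)) Set.univ = ∫⁻ y, (min (p y) (t * q y) : ℝ≥0) ∂M := by
  obtain ⟨h1, h2⟩ := lebesgue_withDensity (m := M) hpm hqm
  have h3 := Measure.eq_rnDeriv (by fun_prop) h1 h2
  rw [withDensity_coe_apply_univ, lintegral_congr_ae
    (g := fun y => ((min (p y / q y) t : ℝ≥0) : ℝ≥0∞))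
    (by filter_upwards [h3] with y hy; rw [← hy, ENNReal.coe_min]),
    lintegral_withDensity_eq_lintegral_mul _ (by fun_prop) (by fun_prop)]
  refine lintegral_congr fun y => ?_
  simp only [Pi.mul_apply, ← ENNReal.coe_mul]
  congr 1
  by_cases hq : q y = 0
  · simp [hq]
  · rw [mul_min, mul_div_cancel₀ _ hq, mul_comm t]

/-- Thinning a plan so that its payload is truncated at density `t` gives a feasible subplan. -/
theorem exists_truncation {f : Z → Y} (hf : Measurable f) (π : Measure Z) {M : Measure Y}
    {p q : Y → ℝ≥0} (hpm : Measurable p) (hqm : Measurable q)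
    (hP : π.map f = M.withDensity fun y => (p y : ℝ≥0∞)) (t : ℝ≥0) :
    ∃ σ : Measure Z, σ ≤ π ∧ σ.map f ≤ t • M.withDensity (fun y => (q y : ℝ≥0∞)) ∧
      σ Set.univ = ∫⁻ y, (min (p y) (t * q y) : ℝ≥0) ∂M := by
  set w : Y → ℝ≥0 := fun y => min (p y) (t * q y) / p y
  have hwm : Measurable w := by fun_prop
  have hmap : (π.withDensity fun z => ((w (f z) : ℝ≥0) : ℝ≥0∞)).map f =
      M.withDensity fun y => ((min (p y) (t * q y) : ℝ≥0) : ℝ≥0∞) := by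
    rw [map_withDensity_comp _ hf (w := fun y => (w y : ℝ≥0∞)) (by fun_prop), hP,
      ← withDensity_mul _ (by fun_prop) (by fun_prop)]
    congr 1
    ext y
    simp only [Pi.mul_apply, ← ENNReal.coe_mul, w]
    congr 1
    by_cases hp : p y = 0
    · simp [hp]
    · rw [mul_div_cancel₀ _ hp]
  refine ⟨π.withDensity fun z => ((w (f z) : ℝ≥0) : ℝ≥0∞), withDensity_le_self _ fun z => ?_,
    ?_, ?_⟩
  · exact_mod_cast div_le_one_of_le₀ (min_le_left _ _) zero_le
  · rw [hmap, ENNReal.smul_def, ← withDensity_smul _ (by fun_prop)]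
    refine withDensity_mono (ae_of_all _ fun y => ?_)
    simp only [Pi.smul_apply, smul_eq_mul, ← ENNReal.coe_mul]
    exact_mod_cast min_le_right _ _
  · rw [← withDensity_coe_apply_univ, ← hmap, Measure.map_apply hf MeasurableSet.univ,
      Set.preimage_univ]

/-- If no exchange below the level `t` is profitable, then no subplan with payload capped at
density `t` exceeds the mass of the truncated payload. -/
theorem mass_le_truncated {f : Z → Y} (hf : Measurable f) {π σ : Measure Z} {lam M : Measure Y}
    {p q : Y → ℝ≥0} (hpm : Measurable p) (hqm : Measurable q)
    (hP : π.map f = M.withDensity fun y => (p y : ℝ≥0∞))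
    (hQ : lam = M.withDensity fun y => (q y : ℝ≥0∞)) {t : ℝ≥0} (ht : 0 < t)
    (hσf : σ.map f ≤ t • lam)
    (hex : ∀ r < t, σ (f ⁻¹' {y | p y < r * q y}) ≤ (π.map f) {y | p y < t * q y}) :
    σ Set.univ ≤ ∫⁻ y, (min (p y) (t * q y) : ℝ≥0) ∂M := by
  set S : Set Y := {y | p y < t * q y}
  have hS : MeasurableSet S := measurableSet_lt hpm (by fun_prop)
  -- Exhaust the region `p < t q` by the regions `p < v n q` with `v n ↑ t`.
  obtain ⟨v, hvm, hv, hvt⟩ := exists_seq_strictMono_tendsto' ht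
  have hunion : f ⁻¹' S = ⋃ n, f ⁻¹' {y | p y < v n * q y} := by
    ext z
    simp only [Set.mem_preimage, Set.mem_iUnion, Set.mem_ofPred_eq, S]
    constructor
    · intro hz
      exact ((hvt.mul_const (q (f z))).eventually (lt_mem_nhds hz)).exists
    · rintro ⟨n, hn⟩
      exact hn.trans_le (mul_le_mul_left (hv n).2.le _)
  have hmono : Monotone fun n => f ⁻¹' {y | p y < v n * q y} := fun m n hmn z hz =>
    lt_of_lt_of_le (show p (f z) < v m * q (f z) from hz) (mul_le_mul_left (hvm.monotone hmn) _)
  have h1 : σ (f ⁻¹' S) ≤ (π.map f) S := by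
    rw [hunion, hmono.measure_iUnion]
    exact iSup_le fun n => hex _ (hv n).2
  have h2 : σ (f ⁻¹' Sᶜ) ≤ (t • lam) Sᶜ := by
    rw [← Measure.map_apply hf hS.compl]
    exact hσf _
  have htq : t • lam = M.withDensity fun y => ((t * q y : ℝ≥0) : ℝ≥0∞) := by
    rw [hQ, ENNReal.smul_def, ← withDensity_smul _ (by fun_prop)]
    congr 1
  calc σ Set.univ = σ (f ⁻¹' S) + σ (f ⁻¹' Sᶜ) := (measure_add_measure_compl (hf hS)).symm
    _ ≤ (π.map f) S + (t • lam) Sᶜ := add_le_add h1 h2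
    _ = ∫⁻ y in S, (min (p y) (t * q y) : ℝ≥0) ∂M + ∫⁻ y in Sᶜ, (min (p y) (t * q y) : ℝ≥0) ∂M := by
        rw [hP, htq, withDensity_apply _ hS, withDensity_apply _ hS.compl]
        congr 1
        · refine setLIntegral_congr_fun hS fun y hy => ?_
          simp only [min_eq_left (show p y < t * q y from hy).le]
        · refine setLIntegral_congr_fun hS.compl fun y hy => ?_
          simp only [min_eq_right (not_lt.1 (show ¬ p y < t * q y from hy))]
    _ = _ := lintegral_add_compl _ hS

end Level

section Transport

variable {Z W : Type u} [MeasurableSpace Z] [MeasurableSpace W]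

theorem divg_map_of_leftInverse {ψ : ℝ≥0 → ℝ≥0∞} (hψ : Measurable ψ) (s : ℝ≥0∞) {e : Z → W}
    {e' : W → Z} (he : Measurable e) (he' : Measurable e') (hee : ∀ z, e' (e z) = z)
    (P Q : Measure Z) [IsFiniteMeasure P] [IsFiniteMeasure Q] :
    divg ψ s (P.map e) (Q.map e) = divg ψ s P Q := by
  obtain ⟨p, q, hpm, hqm, -, hP, hQ⟩ := exists_density_pair P Q
  have h1 : ∀ u : Z → ℝ≥0, Measurable u →
      ((P + Q).withDensity fun z => (u z : ℝ≥0∞)).map e =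
        ((P + Q).map e).withDensity fun w => ((u (e' w) : ℝ≥0) : ℝ≥0∞) := by
    intro u hu
    rw [← map_withDensity_comp (P + Q) he (w := fun w => ((u (e' w) : ℝ≥0) : ℝ≥0∞)) (by fun_prop)]
    simp only [hee]
  have hP' : P.map e = ((P + Q).map e).withDensity fun w => ((p (e' w) : ℝ≥0) : ℝ≥0∞) := by
    rw [← h1 p hpm, ← hP]
  have hQ' : Q.map e = ((P + Q).map e).withDensity fun w => ((q (e' w) : ℝ≥0) : ℝ≥0∞) := by
    rw [← h1 q hqm, ← hQ]
  have hf1 : IsFiniteMeasure (((P + Q).map e).withDensity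
      fun w => ((q (e' w) : ℝ≥0) : ℝ≥0∞)) := by rw [← hQ']; infer_instance
  have hf2 : IsFiniteMeasure ((P + Q).withDensity fun z => (q z : ℝ≥0∞)) := by
    rw [← hQ]; infer_instance
  have e1 : divg ψ s P Q = ∫⁻ z, persp ψ s (p z) (q z) ∂(P + Q) := by
    rw [← divg_withDensity hψ s hpm hqm, ← hP, ← hQ]
  rw [hP', hQ', divg_withDensity hψ s (p := fun w => p (e' w)) (q := fun w => q (e' w))
    (by fun_prop) (by fun_prop),
    lintegral_map (measurable_persp hψ s (by fun_prop) (by fun_prop)) he,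
    e1]
  simp only [hee]

end Transport

section Plans

variable {Ω : Bool → Type u}

/-- The inverse of `join`. -/
def split : (i : Bool) → Ω false × Ω true → Ω (!i) × Ω i
  | false, p => (p.2, p.1)
  | true, p => (p.1, p.2)

theorem join_split (i : Bool) (z : Ω false × Ω true) : join i (split i z) = z := by
  cases i <;> rfl

variable [∀ i, MeasurableSpace (Ω i)]

theorem measurable_proj (i : Bool) : Measurable (proj (Ω := Ω) i) := by
  cases i
  exacts [measurable_fst, measurable_snd]

theorem measurable_join (i : Bool) : Measurable (join (Ω := Ω) i) := by
  cases i
  exacts [measurable_snd.prodMk measurable_fst, measurable_fst.prodMk measurable_snd]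

theorem measurable_split (i : Bool) : Measurable (split (Ω := Ω) i) := by
  cases i
  exacts [measurable_snd.prodMk measurable_fst, measurable_fst.prodMk measurable_snd]

theorem map_split_fst (i : Bool) (π : Measure (Ω false × Ω true)) :
    (π.map (split i)).fst = π.map (proj (!i)) := by
  rw [Measure.fst, Measure.map_map measurable_fst (measurable_split i)]
  cases i <;> rfl

theorem map_split_map_join (i : Bool) (π : Measure (Ω false × Ω true)) :
    (π.map (split i)).map (join i) = π := by
  rw [Measure.map_map (measurable_join i) (measurable_split i)]
  have : join (Ω := Ω) i ∘ split i = id := funext (join_split i)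
  rw [this, Measure.map_id]

theorem map_univ {Z W : Type*} [MeasurableSpace Z] [MeasurableSpace W] {f : Z → W}
    (hf : Measurable f) (π : Measure Z) : π.map f Set.univ = π Set.univ := by
  rw [Measure.map_apply hf MeasurableSet.univ, Set.preimage_univ]

variable {E : Set (Ω false × Ω true)} {ν : ∀ i, Measure (Ω i)} {i : Bool}

/-- A kernel that disintegrates both plans along the side `!i` exhibits the second plan as a
proportional response to the first. -/
theorem isProportionalResponse_of_kernel [∀ i, IsFiniteMeasure (ν i)]
    {π π' : Measure (Ω false × Ω true)} (hπ : π ∈ plans E ν i) (hπ' : π' ∈ plans E ν (!i))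
    {κ : Kernel (Ω (!i)) (Ω i)} [IsMarkovKernel κ] (h : π = kernelProduct i (payload i π) κ)
    (h' : π' = kernelProduct i (ν (!i)) κ) : IsProportionalResponse E ν i π π' := by
  have := hπ.1
  have : IsFiniteMeasure (payload i π) := by unfold payload; infer_instance
  refine ⟨hπ, κ, κ, ⟨fun y => inferInstance, h⟩, inferInstance, ?_, ?_⟩
  · refine (Measure.singularPart_le _ _).absolutelyContinuous ?_
    have h0 := hπ'.2.1
    rw [h', kernelProduct] at h0
    have h1 : ∀ᵐ z ∂(ν (!i) ⊗ₘ κ), join i z ∈ E := by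
      have := measure_eq_zero_iff_ae_notMem.1 h0
      filter_upwards [ae_of_ae_map (measurable_join i).aemeasurable this] with z hz
      simpa using hz
    filter_upwards [Measure.ae_ae_of_ae_compProd h1] with y hy
    exact hy
  · conv_lhs => rw [h', ← (ν (!i)).rnDeriv_add_singularPart (payload i π)]
    rw [kernelProduct, kernelProduct, kernelProduct, Measure.compProd_add_left,
      Measure.map_add _ _ (measurable_join i)]

/-- The first two structural properties of a closest pair for a strictly convex integrand. -/
theorem structure_of_isClosestPair [∀ i, StandardBorelSpace (Ω i)] [Nonempty (Ω i)]
    [∀ i, IsFiniteMeasure (ν i)] {θ : ℝ≥0 → EReal} (hp : IsProper θ) (hl : LowerSemicontinuous θ)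
    (hc : IsStrictlyConvexOnDom θ) {π π' : Measure (Ω false × Ω true)}
    (hcl : IsClosestPair (thetaDiv θ) E ν i π π') (hfin : thetaDiv θ (Ω false × Ω true) π π' < ⊤) :
    IsLevelOptimalMaximin E ν i π ∧ IsProportionalResponse E ν i π π' := by
  obtain ⟨hπ, hπ', hinf⟩ := hcl
  have := hπ.1
  have := hπ'.1
  have hfm := measurable_proj (Ω := Ω) (!i)
  have hgm := measurable_proj (Ω := Ω) i
  obtain ⟨A, B, hmino⟩ := hc.exists_minorant hp
  obtain ⟨ψ, s, hn⟩ := exists_isNormalization hl.measurable hmino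
  obtain ⟨hproj, hker⟩ := hn.divg_fst hc hp (π.map (split i)) (π'.map (split i))
  rw [divg_map_of_leftInverse hn.measurable s (measurable_split i) (measurable_join i)
    (join_split i), map_split_fst, map_split_fst, hπ'.2.2] at hproj hker
  have hD := hn.divg_ne_top hfin
  have hle : thetaDiv θ (Ω (!i)) (π.map (proj (!i))) (ν (!i)) ≤
      thetaDiv θ (Ω false × Ω true) π π' :=
    (hn.thetaDiv_le_iff (map_univ hfm π) (by rw [← hπ'.2.2, map_univ hfm])).2 hproj
  -- Passing to responses, the divergence of the pair is below that of any payload.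
  have hge : ∀ ρ ∈ plans E ν i, thetaDiv θ (Ω false × Ω true) π π' ≤
      thetaDiv θ (Ω (!i)) (ρ.map (proj (!i))) (ν (!i)) := by
    intro ρ hρ
    have := hρ.1
    obtain ⟨ρ', hfin', hac, hmap, hdiv⟩ := exists_response hfm ρ π'
    have hρ' : ρ' ∈ plans E ν (!i) := ⟨hfin', hac (by
      rw [Measure.add_apply, hρ.2.1, hπ'.2.1, add_zero]), hmap.trans hπ'.2.2⟩
    rw [hinf]
    refine (iInf₂_le_of_le ρ hρ (iInf₂_le ρ' hρ')).trans ?_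
    refine (hn.thetaDiv_le_iff (map_univ hfm ρ).symm ?_).2 ?_
    · rw [← hπ'.2.2, ← hmap, map_univ hfm]
    · rw [hdiv ψ s hn.measurable, hπ'.2.2]
  have hfin₁ := hle.trans_lt hfin
  constructor
  · refine ⟨hπ, fun t ht => ?_⟩
    obtain ⟨p, q, hpm, hqm, -, hP, hQ⟩ := exists_density_pair (π.map (proj (!i))) (ν (!i))
    generalize π.map (proj (!i)) + ν (!i) = M at hP hQ
    have hfinQ : IsFiniteMeasure (M.withDensity fun y => (q y : ℝ≥0∞)) := by
      rw [← hQ]; infer_instance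
    rw [truncatedPayload, payload, hP, hQ, truncated_mass hpm hqm]
    refine le_antisymm ?_ (iSup₂_le fun σ hσ => ?_)
    · obtain ⟨σ, hσπ, hσf, hσm⟩ := exists_truncation hfm π hpm hqm hP t
      rw [← hσm]
      refine le_iSup₂_of_le σ ⟨isFiniteMeasure_of_le _ hσπ, ?_, ?_, by rwa [hQ]⟩ le_rfl
      · exact le_antisymm ((hσπ _).trans_eq hπ.2.1) zero_le
      · rw [← hπ.2.2]
        exact Measure.map_mono hσπ hgm
    · obtain ⟨hσfin, hσE, hσg, hσf⟩ := hσ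
      refine mass_le_truncated hfm hpm hqm hP hQ ht hσf fun r hr => ?_
      refine exchange hl hc hp hfm hgm hpm hqm hP hQ hfin₁ (fun ρ hρfin hρac hρg => ?_) hr
        (by rwa [hπ.2.2]) hσf
      refine hle.trans (hge ρ ⟨hρfin, hρac ?_, hρg.trans hπ.2.2⟩)
      rw [Measure.add_apply, hπ.2.1, hσE, add_zero]
  · obtain ⟨κ, hκ, h1, h2⟩ := hker hD ((hn.thetaDiv_le_iff (map_univ hfm π).symm
      (by rw [← hπ'.2.2, map_univ hfm])).1 (hge π hπ))
    refine isProportionalResponse_of_kernel hπ hπ' (κ := κ) ?_ ?_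
    · rw [kernelProduct, payload, ← h1, map_split_map_join]
    · rw [kernelProduct, ← h2, map_split_map_join]

/-- A nonzero measure at finite divergence forces a point of the domain other than `0`. -/
theorem exists_ne_zero_dom {θ : ℝ≥0 → EReal} (hp : IsProper θ) (hl : LowerSemicontinuous θ)
    (hc : IsStrictlyConvexOnDom θ) {Z : Type u} [MeasurableSpace Z] {P Q : Measure Z}
    [IsFiniteMeasure P] [IsFiniteMeasure Q] (hP0 : P ≠ 0) (hfin : thetaDiv θ Z P Q < ⊤) :
    ∃ z, z ≠ 0 ∧ θ z ≠ ⊤ := by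
  obtain ⟨A, B, hmino⟩ := hc.exists_minorant hp
  obtain ⟨ψ, s, hn⟩ := exists_isNormalization hl.measurable hmino
  have hD := hn.divg_ne_top hfin
  obtain ⟨p, q, hpm, hqm, -, hP, hQ⟩ := exists_density_pair P Q
  generalize P + Q = m at hP hQ
  subst hP hQ
  rw [divg_withDensity hn.measurable s hpm hqm] at hD
  have hae := ae_lt_top (measurable_persp hn.measurable s hpm hqm) hD
  obtain ⟨x, hx, hxt⟩ : ∃ x, p x ≠ 0 ∧ persp ψ s (p x) (q x) ≠ ⊤ := by
    by_contra hcon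
    push Not at hcon
    refine hP0 ((withDensity_eq_zero_iff (by fun_prop)).2 ?_)
    filter_upwards [hae] with x hx
    by_contra h0
    exact hx.ne (hcon x fun h1 => h0 (by simp [h1]))
  by_cases hq : q x = 0
  · obtain ⟨x₀, hx₀⟩ := hp.2
    have hs : s ≠ ⊤ := fun hs => hxt (by
      rw [persp, if_pos hq, hs, ENNReal.mul_top (by simpa using hx)])
    exact ⟨x₀ + 1, by positivity, hc.ne_top_of_recessionSlope hp (hn.slope_ne_top_iff.1 hs)
      (lt_add_one x₀).le hx₀⟩
  · exact ⟨p x / q x, div_ne_zero hx hq, hn.ne_top_iff.1 ((persp_ne_top_iff_of_ne hq).1 hxt)⟩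

theorem plans_not_not (E : Set (Ω false × Ω true)) (ν : ∀ i, Measure (Ω i)) (i : Bool) :
    plans E ν (!!i) = plans E ν i := by
  cases i <;> rfl

theorem IsClosestPair.adjoint {θ : ℝ≥0 → EReal} {π π' : Measure (Ω false × Ω true)}
    (hsymm : ∀ ρ ∈ plans E ν i, ∀ ρ' ∈ plans E ν (!i), thetaDiv θ (Ω false × Ω true) ρ ρ' =
      thetaDiv (Refinement.adjoint θ) (Ω false × Ω true) ρ' ρ)
    (hcl : IsClosestPair (thetaDiv θ) E ν i π π') :
    IsClosestPair (thetaDiv (Refinement.adjoint θ)) E ν (!i) π' π := by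
  obtain ⟨hπ, hπ', hinf⟩ := hcl
  refine ⟨hπ', by rwa [plans_not_not], ?_⟩
  rw [plans_not_not, iInf₂_comm, ← hsymm π hπ π' hπ', hinf]
  exact biInf_congr fun ρ hρ => biInf_congr fun ρ' hρ' => hsymm ρ hρ ρ' hρ'

end Plans

/-! ### A strictly convex divergence with data processing -/

section Universal

/-- The integrand `t ↦ 1 / (1 + t)`: strictly convex, and its divergence is always finite. -/
noncomputable def invIntegrand (t : ℝ≥0) : EReal := (((1 + t)⁻¹ : ℝ) : EReal)

theorem invIntegrand_isProper : IsProper invIntegrand :=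
  ⟨fun _ => EReal.coe_ne_bot _, 0, EReal.coe_ne_top _⟩

theorem invIntegrand_lowerSemicontinuous : LowerSemicontinuous invIntegrand := by
  refine Continuous.lowerSemicontinuous (continuous_coe_real_ereal.comp ?_)
  exact Continuous.inv₀ (by fun_prop) fun t => by positivity

theorem invIntegrand_isStrictlyConvexOnDom : IsStrictlyConvexOnDom invIntegrand := by
  intro x y _ _ hxy a b ha hb hab
  have ha' : (0 : ℝ) < a := ha
  have hb' : (0 : ℝ) < b := hb
  have hb1 : (b : ℝ) = 1 - a := by
    have : (a : ℝ) + b = 1 := by exact_mod_cast hab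
    linarith
  have hxy' : ((x : ℝ) - y) ≠ 0 := sub_ne_zero.2 fun h => hxy (NNReal.coe_injective h)
  simp only [invIntegrand]
  rw [← EReal.coe_mul, ← EReal.coe_mul, ← EReal.coe_add, EReal.coe_lt_coe_iff]
  push_cast
  have hx : (0 : ℝ) < 1 + x := by positivity
  have hy : (0 : ℝ) < 1 + y := by positivity
  have hc : (0 : ℝ) < 1 + (a * x + b * y) := by positivity
  rw [← div_eq_mul_inv, ← div_eq_mul_inv, div_add_div _ _ hx.ne' hy.ne', inv_eq_one_div,
    div_lt_div_iff₀ hc (mul_pos hx hy)]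
  have h : ((a : ℝ) * (1 + y) + (1 + x) * b) * (1 + (a * x + b * y)) - 1 * ((1 + x) * (1 + y)) =
      a * b * (x - y) ^ 2 := by
    rw [hb1]; ring
  have : 0 < (a : ℝ) * b * (x - y) ^ 2 := by positivity
  linarith

theorem invIntegrand_isNormalization :
    IsNormalization invIntegrand 0 0 (fun t => (((1 + t)⁻¹ : ℝ≥0) : ℝ≥0∞)) 0 := by
  refine ⟨by fun_prop, fun t => ?_, ?_⟩
  · simp only [invIntegrand, zero_mul, add_zero, EReal.coe_zero]
    rfl
  · have h : Tendsto (fun t : ℝ≥0 => (((1 + t)⁻¹ / t : ℝ) : EReal)) atTop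
        (nhds ((0 : ℝ) : EReal)) := by
      refine (continuous_coe_real_ereal.tendsto 0).comp ?_
      have h1 : Tendsto (fun t : ℝ≥0 => (t : ℝ)) atTop atTop :=
        NNReal.tendsto_coe_atTop.2 tendsto_id
      exact (tendsto_inv_atTop_zero.comp (tendsto_atTop_add_const_left _ 1 h1)).div_atTop h1
    rw [recessionSlope]
    simpa [invIntegrand, EReal.coe_div] using h.limsup_eq

theorem persp_inv {p q : ℝ≥0} (h : p + q = 1) :
    persp (fun t => (((1 + t)⁻¹ : ℝ≥0) : ℝ≥0∞)) 0 p q = ((q ^ 2 : ℝ≥0) : ℝ≥0∞) := by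
  by_cases hq : q = 0
  · simp [persp, hq]
  · rw [persp, if_neg hq, ← ENNReal.coe_mul]
    congr 1
    have : 1 + p / q = 1 / q := by
      rw [eq_div_iff hq, add_mul, one_mul, div_mul_cancel₀ _ hq, add_comm, h]
    rw [this]
    field_simp

variable {X Y : Type u} [MeasurableSpace X] [MeasurableSpace Y]

theorem thetaDiv_invIntegrand {P Q : Measure X} [IsFiniteMeasure P] [IsFiniteMeasure Q]
    {p q : X → ℝ≥0} (hpm : Measurable p) (hqm : Measurable q) (hpq : ∀ x, p x + q x = 1)
    (hP : P = (P + Q).withDensity fun x => (p x : ℝ≥0∞))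
    (hQ : Q = (P + Q).withDensity fun x => (q x : ℝ≥0∞)) :
    thetaDiv invIntegrand X P Q = ((∫⁻ x, (q x ^ 2 : ℝ≥0) ∂(P + Q) : ℝ≥0∞) : EReal) := by
  have hf : IsFiniteMeasure ((P + Q).withDensity fun x => (q x : ℝ≥0∞)) := by
    rw [← hQ]; infer_instance
  have e : divg (fun t => (((1 + t)⁻¹ : ℝ≥0) : ℝ≥0∞)) 0 P Q =
      ∫⁻ x, (q x ^ 2 : ℝ≥0) ∂(P + Q) := by
    rw [← lintegral_congr fun x => persp_inv (hpq x),
      ← divg_withDensity invIntegrand_isNormalization.measurable 0 hpm hqm, ← hP, ← hQ]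
  rw [invIntegrand_isNormalization.thetaDiv_eq, e]
  simp

theorem lintegral_sq_density_ne_top {m : Measure X} [IsFiniteMeasure m] {q : X → ℝ≥0}
    (hq : ∀ x, q x ≤ 1) : ∫⁻ x, (q x ^ 2 : ℝ≥0) ∂m ≠ ⊤ := by
  refine ne_top_of_le_ne_top (measure_ne_top m Set.univ) ?_
  calc ∫⁻ x, (q x ^ 2 : ℝ≥0) ∂m ≤ ∫⁻ _, 1 ∂m :=
        lintegral_mono fun x => ENNReal.coe_le_one_iff.2 (pow_le_one₀ zero_le (hq x))
    _ = _ := lintegral_one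

theorem thetaDiv_invIntegrand_lt_top (P Q : Measure X) [IsFiniteMeasure P] [IsFiniteMeasure Q] :
    thetaDiv invIntegrand X P Q < ⊤ := by
  obtain ⟨p, q, hpm, hqm, hpq, hP, hQ⟩ := exists_density_pair P Q
  rw [thetaDiv_invIntegrand hpm hqm hpq hP hQ]
  have h := lintegral_sq_density_ne_top (m := P + Q) (q := q)
    fun x => (le_add_of_nonneg_left zero_le).trans_eq (hpq x)
  rwa [lt_top_iff_ne_top, ne_eq, EReal.coe_ennreal_eq_top_iff]

/-- With `q` the density of the second measure with respect to the sum, the divergence is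
`∫ q ²`.  For the images `∫ q' ² = ∫ ∫ q(x) q'(y) K(x, dy)`, and `2 q q' ≤ q ² + q' ²`. -/
theorem satisfiesDPI_invIntegrand : SatisfiesDPI.{u} (thetaDiv invIntegrand) := by
  intro X Y _ _ K _ P Q _ _
  obtain ⟨p, q, hpm, hqm, hpq, hP, hQ⟩ := exists_density_pair P Q
  obtain ⟨p', q', hpm', hqm', hpq', hP', hQ'⟩ := exists_density_pair (P.bind K) (Q.bind K)
  rw [thetaDiv_invIntegrand hpm hqm hpq hP hQ, thetaDiv_invIntegrand hpm' hqm' hpq' hP' hQ',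
    EReal.coe_ennreal_le_coe_ennreal_iff]
  have hfin := lintegral_sq_density_ne_top (m := P.bind K + Q.bind K) (q := q')
    fun x => (le_add_of_nonneg_left zero_le).trans_eq (hpq' x)
  have hbind : ∀ u : Y → ℝ≥0∞, Measurable u →
      ∫⁻ y, u y ∂(P.bind K + Q.bind K) = ∫⁻ x, ∫⁻ y, u y ∂K x ∂(P + Q) := by
    intro u hu
    rw [lintegral_add_measure, lintegral_add_measure, Measure.lintegral_bind K.aemeasurable
      hu.aemeasurable, Measure.lintegral_bind K.aemeasurable hu.aemeasurable]
  have hI : ∫⁻ y, (q' y ^ 2 : ℝ≥0) ∂(P.bind K + Q.bind K) =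
      ∫⁻ x, ∫⁻ y, (q x * q' y : ℝ≥0) ∂K x ∂(P + Q) := by
    calc ∫⁻ y, (q' y ^ 2 : ℝ≥0) ∂(P.bind K + Q.bind K) = ∫⁻ y, q' y ∂(Q.bind K) := by
          conv_rhs => rw [hQ']
          rw [lintegral_withDensity_eq_lintegral_mul _ (by fun_prop) (by fun_prop)]
          simp [sq]
      _ = ∫⁻ x, ∫⁻ y, q' y ∂K x ∂Q :=
          Measure.lintegral_bind K.aemeasurable (by fun_prop)
      _ = ∫⁻ x, q x * ∫⁻ y, q' y ∂K x ∂(P + Q) := by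
          conv_lhs => rw [hQ]
          rw [lintegral_withDensity_eq_lintegral_mul _ (by fun_prop)
            (Measurable.lintegral_kernel (by fun_prop))]
          rfl
      _ = _ := by
          refine lintegral_congr fun x => ?_
          rw [← lintegral_const_mul _ (by fun_prop)]
          simp
  have hkey : 2 * ∫⁻ y, (q' y ^ 2 : ℝ≥0) ∂(P.bind K + Q.bind K) ≤
      ∫⁻ x, (q x ^ 2 : ℝ≥0) ∂(P + Q) + ∫⁻ y, (q' y ^ 2 : ℝ≥0) ∂(P.bind K + Q.bind K) := by
    calc 2 * ∫⁻ y, (q' y ^ 2 : ℝ≥0) ∂(P.bind K + Q.bind K)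
        = ∫⁻ x, ∫⁻ y, (2 * (q x * q' y) : ℝ≥0) ∂K x ∂(P + Q) := by
          rw [hI, ← lintegral_const_mul' _ _ (by simp)]
          refine lintegral_congr fun x => ?_
          rw [← lintegral_const_mul' _ _ (by simp)]
          simp
      _ ≤ ∫⁻ x, ∫⁻ y, ((q x ^ 2 : ℝ≥0) : ℝ≥0∞) + (q' y ^ 2 : ℝ≥0) ∂K x ∂(P + Q) := by
          refine lintegral_mono fun x => lintegral_mono fun y => ?_
          rw [← ENNReal.coe_add, ENNReal.coe_le_coe, ← mul_assoc]
          exact two_mul_le_add_sq _ _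
      _ = ∫⁻ x, (q x ^ 2 : ℝ≥0) ∂(P + Q) + ∫⁻ x, ∫⁻ y, (q' y ^ 2 : ℝ≥0) ∂K x ∂(P + Q) := by
          rw [← lintegral_add_left (by fun_prop)]
          refine lintegral_congr fun x => ?_
          rw [lintegral_add_left (by fun_prop)]
          simp
      _ = _ := by rw [hbind _ (by fun_prop)]
  rw [two_mul] at hkey
  exact (ENNReal.add_le_add_iff_right hfin).1 hkey

end Universal

end Refinement


theorem mainTheorem2 {Ω : Bool → Type u} [∀ i, TopologicalSpace (Ω i)] [∀ i, PolishSpace (Ω i)]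
    [∀ i, MeasurableSpace (Ω i)] [∀ i, BorelSpace (Ω i)]
    (E : Set (Ω false × Ω true)) (hE : IsClosed E)
    (hN : ∀ (i : Bool) (y : Ω (!i)), (Refinement.nbhd E i y).Nonempty)
    (ν : ∀ i, Measure (Ω i)) [∀ i, IsFiniteMeasure (ν i)] (hν : ∀ i, 0 < ν i Set.univ)
    (i : Bool) :
    (∀ θ : ℝ≥0 → EReal, Refinement.IsProper θ → LowerSemicontinuous θ →
      Refinement.IsStrictlyConvexOnDom θ →
      ∀ π π' : Measure (Ω false × Ω true),
        Refinement.IsClosestPair (Refinement.thetaDiv θ) E ν i π π' →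
        Refinement.thetaDiv θ (Ω false × Ω true) π π' < ⊤ →
        -- the structure of the pair
        Refinement.IsLevelOptimalMaximin E ν i π ∧
        Refinement.IsProportionalResponse E ν i π π' ∧
        -- the hypotheses are symmetric under the adjoint integrand and exchange of the sides
        (Refinement.IsProper (Refinement.adjoint θ) ∧
          LowerSemicontinuous (Refinement.adjoint θ) ∧
          Refinement.IsStrictlyConvexOnDom (Refinement.adjoint θ) ∧
          (∀ ρ ∈ Refinement.plans E ν i, ∀ ρ' ∈ Refinement.plans E ν (!i),
            Refinement.thetaDiv θ (Ω false × Ω true) ρ ρ' =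
              Refinement.thetaDiv (Refinement.adjoint θ) (Ω false × Ω true) ρ' ρ) ∧
          Refinement.IsClosestPair (Refinement.thetaDiv (Refinement.adjoint θ)) E ν (!i) π' π ∧
          Refinement.thetaDiv (Refinement.adjoint θ) (Ω false × Ω true) π' π < ⊤) ∧
        -- and so is the structure of the pair
        Refinement.IsLevelOptimalMaximin E ν (!i) π' ∧
        Refinement.IsProportionalResponse E ν (!i) π' π) ∧
    -- in particular, universal closest pairs have this structure
    (∀ π π' : Measure (Ω false × Ω true),
      Refinement.IsUniversalClosestPair E ν i π π' →
      Refinement.IsLevelOptimalMaximin E ν i π ∧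
      Refinement.IsProportionalResponse E ν i π π' ∧
      Refinement.IsLevelOptimalMaximin E ν (!i) π' ∧
      Refinement.IsProportionalResponse E ν (!i) π' π) := by
  have hne : ∀ j, Nonempty (Ω j) := fun j => by
    by_contra h
    rw [not_nonempty_iff] at h
    exact (hν j).ne' (by rw [Set.univ_eq_empty_iff.2 h, measure_empty])
  refine (fun h => ⟨h, fun π π' hu => ?_⟩) ?_
  · intro θ hp hl hc π π' hcl hfin
    have := hcl.1.1
    have := hcl.2.1.1
    have hπ0 : π ≠ 0 := by
      rintro rfl
      have h := hcl.1.2.2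
      rw [Measure.map_zero] at h
      exact (hν i).ne' (by rw [← h]; rfl)
    obtain ⟨z, hz0, hz⟩ := Refinement.exists_ne_zero_dom hp hl hc hπ0 hfin
    have hp' := hc.adjoint_isProper hp hz0 hz
    have hl' := hc.adjoint_lowerSemicontinuous hp hl
    have hc' := hc.adjoint hp
    have hsymm : ∀ ρ ∈ Refinement.plans E ν i, ∀ ρ' ∈ Refinement.plans E ν (!i),
        Refinement.thetaDiv θ (Ω false × Ω true) ρ ρ' =
          Refinement.thetaDiv (Refinement.adjoint θ) (Ω false × Ω true) ρ' ρ := by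
      intro ρ hρ ρ' hρ'
      have := hρ.1
      have := hρ'.1
      exact Refinement.thetaDiv_adjoint hc hp hl hz0 hz ρ ρ'
    have hcl' := hcl.adjoint hsymm
    have hfin' : Refinement.thetaDiv (Refinement.adjoint θ) (Ω false × Ω true) π' π < ⊤ := by
      rwa [← hsymm π hcl.1 π' hcl.2.1]
    obtain ⟨h1, h2⟩ := Refinement.structure_of_isClosestPair hp hl hc hcl hfin
    obtain ⟨h3, h4⟩ := Refinement.structure_of_isClosestPair hp' hl' hc' hcl' hfin'
    exact ⟨h1, h2, ⟨hp', hl', hc', hsymm, hcl', hfin'⟩, h3, h4⟩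
  · have hcl := hu _ Refinement.satisfiesDPI_invIntegrand
    have := hcl.1.1
    have := hcl.2.1.1
    obtain ⟨h1, h2, -, h3⟩ := h _ Refinement.invIntegrand_isProper
      Refinement.invIntegrand_lowerSemicontinuous Refinement.invIntegrand_isStrictlyConvexOnDom
      π π' hcl (Refinement.thetaDiv_invIntegrand_lt_top π π')
    exact ⟨h1, h2, h3⟩
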